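/- **Notation.** For a positive integer $n$ put $[n-1]_0=\{0,1,\dots,n-1\}$ and $[\pm n]_0=\{-n,\dots,n\}$. Let $B_n$ be the hyperoctahedral group, i.e. the group of permutations $w$ of $[\pm n]_0$ with $w(-j)=-w(j)$ for all $j$, with Coxeter generators $s_0,\dots,s_{n-1}$: in window notation $[w(1),\dots,w(n)]$, $s_0=[-1,2,\dots,n]$ and $s_i=[1,\dots,i-1,i+1,i,i+2,\dots,n]$ for $1\le i\le n-1$. Let $l$ be the Coxeter length on $B_n$ with respect to these generators, let $D(w)=\{i\in[n-1]_0 : l(ws_i)<l(w)\}$, and put $$L(w)=\tfrac12\,\#\{(i,j)\in[\pm n]_0^2 : i<j,\ w(i)>w(j),\ i\not\equiv j \bmod 2\}.$$ For $I\subseteq[n-1]_0$ let $I^{\mathrm c}=[n-1]_0\setminus I$ and $B_n^{I^{\mathrm c}}=\{w\in B_n : D(w)\subseteq I\}$. Let $(\underline{k})_q=1-q^k$ for $k\ge1$, $(\underline 0)_q=1$, and $(\underline k)_q!=(\underline1)_q(\underline2)_q\cdots(\underline k)_q$; the index is omitted when $q=X$ is the indeterminate. For $I=\{i_1<\dots<i_l\}\subseteq[n-1]_0$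 put $i_{l+1}=n$ (so $i_1=n$ if $I=\varnothing$), and $$f_{n,I}(X)=\frac{(\underline n)!}{(\underline{i_1})!}\prod_{r=1}^{l}\ \prod_{\sigma=1}^{\lfloor (i_{r+1}-i_r)/2\rfloor}(\underline{2\sigma})^{-1}.$$ For even $n$ and a set $I$ of even integers let $$\binom{n/2}{I/2}_{q}=\prod_{r=1}^{l}\frac{(\underline{i_{r+1}/2})_q!}{(\underline{i_{r+1}/2-i_r/2})_q!\,(\underline{i_r/2})_q!}.$$ **Theorem 1.2.** Let $n\ge1$ and $I\subseteq[n-1]_0$. The identity $$\sum_{w\in B_n^{I^{\mathrm c}}}(-1)^{l(w)}X^{L(w)}=f_{n,I}(X)$$ holds in each of the following cases, in which $f_{n,I}$ also has the stated form: 1. $I=\{0\}$; here $f_{n,I}(X)=(\underline1)(\underline3)\cdots(\underline{\tilde n})$, where $\tilde n$ is the largest odd integer not exceeding $n$. 2. $I=[n-1]_0$; here $f_{n,I}(X)=(\underline n)!$. 3. $n$ is even and every element of $I$ is even; here $$f_{n,I}(X)=\binom{n/2}{I/2}_{X^2}\,\frac{(\underline1)(\underline3)\cdots(\underline{n-1})}{(\underline1)(\underline3)\cdots(\underline{i_1-1})},$$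 where the denominator is $1$ if $i_1=0$. -/

import Mathlib

open Finset Polynomial

namespace Hyperoctahedral

/-- The set `[±n]₀ = {-n, …, n}` of integers. -/
abbrev PM (n : ℕ) : Type := {x : ℤ // -(n : ℤ) ≤ x ∧ x ≤ n}

instance (n : ℕ) : DecidableEq (PM n) := Subtype.instDecidableEq

noncomputable instance (n : ℕ) : Fintype (PM n) :=
  Fintype.subtype (Finset.Icc (-(n : ℤ)) n) fun _ => Finset.mem_Icc

/-- The point `k` of `[±n]₀`, for a natural number `k ≤ n`. -/
def pt {n : ℕ} (k : ℕ) (hk : k ≤ n) : PM n :=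
  ⟨(k : ℤ), by omega⟩

instance (n : ℕ) : InvolutiveNeg (PM n) where
  neg x := ⟨-x.1, by have := x.2; omega⟩
  neg_neg x := Subtype.ext (neg_neg x.1)

theorem neg_val {n : ℕ} (y : PM n) : (-y).1 = -y.1 := rfl

theorem pt_val {n : ℕ} (k : ℕ) (hk : k ≤ n) : (pt k hk).1 = (k : ℤ) := rfl

/-- The hyperoctahedral group `B_n`: the permutations `w` of `[±n]₀` with `w(-j) = -w(j)` for
all `j`, under composition. -/
def B (n : ℕ) : Subgroup (Equiv.Perm (PM n)) where
  carrier := {w | ∀ j, w (-j) = -w j}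
  mul_mem' := by
    intro a b ha hb j
    rw [Equiv.Perm.mul_apply, Equiv.Perm.mul_apply, hb j, ha]
  one_mem' := fun _ => rfl
  inv_mem' := by
    intro a ha j
    rw [Equiv.Perm.inv_eq_iff_eq, ha, Equiv.Perm.coe_inv, Equiv.apply_symm_apply]

noncomputable instance (n : ℕ) : DecidablePred (· ∈ B n) :=
  fun w => inferInstanceAs (Decidable (∀ j, w (-j) = -w j))

/-- The underlying permutation of the `i`-th generator: `s_0 = [-1, 2, …, n]` exchanges `1` and
`-1`; for `i ≥ 1`, `s_i = [1, …, i-1, i+1, i, i+2, …, n]` exchanges `i` with `i+1` and `-i` with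
`-(i+1)`. -/
def genPerm (n : ℕ) (i : Fin n) : Equiv.Perm (PM n) :=
  if (i : ℕ) = 0 then
    Equiv.swap (pt (i + 1) i.2) (-pt (i + 1) i.2)
  else
    Equiv.swap (pt i i.2.le) (pt (i + 1) i.2) * Equiv.swap (-pt i i.2.le) (-pt (i + 1) i.2)

theorem genPerm_mem (n : ℕ) (i : Fin n) : genPerm n i ∈ B n := by
  intro j
  unfold genPerm
  split_ifs with h
  · simp only [Equiv.swap_apply_def]
    split_ifs <;> simp only [Subtype.ext_iff, neg_val, pt_val] at * <;> omega
  · simp only [Equiv.Perm.mul_apply, Equiv.swap_apply_def]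
    split_ifs <;> simp only [Subtype.ext_iff, neg_val, pt_val] at * <;> omega

/-- The Coxeter generators `s_0, …, s_{n-1}` of `B_n`. -/
def s (n : ℕ) (i : Fin n) : B n := ⟨genPerm n i, genPerm_mem n i⟩

/-- The Coxeter length `l(w)` with respect to `s_0, …, s_{n-1}`: the least number of factors in
an expression of `w` as a product of generators. -/
noncomputable def len {n : ℕ} (w : B n) : ℕ :=
  sInf {k | ∃ ω : List (Fin n), ω.length = k ∧ (ω.map (s n)).prod = w}

/-- The statistic
`L(w) = (1/2) #{(i,j) ∈ [±n]₀² : i < j, w(i) > w(j), i ≢ j mod 2}`.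
The cardinality is even because `(i,j) ↦ (-j,-i)` acts without fixed points, see
`two_mul_L`. -/
noncomputable def L {n : ℕ} (w : B n) : ℕ :=
  #{p : PM n × PM n | p.1.1 < p.2.1 ∧ (w.1 p.2).1 < (w.1 p.1).1 ∧ ¬ p.1.1 ≡ p.2.1 [ZMOD 2]} / 2

/-- The (right) descent set `D(w) = {i ∈ [n-1]₀ : l(w s_i) < l(w)}`. -/
noncomputable def D {n : ℕ} (w : B n) : Finset ℕ :=
  ({i : Fin n | len (w * s n i) < len w} : Finset (Fin n)).map Fin.valEmbedding

/-- The quotient `B_n^J = {w ∈ B_n : D(w) ⊆ J^c}`, where `J^c = [n-1]₀ \ J`. -/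
noncomputable def quotient (n : ℕ) (J : Finset ℕ) : Finset (B n) :=
  {w : B n | D w ⊆ range n \ J}

/-- The signed distribution `∑_{w ∈ B_n^{I^c}} (-1)^{l(w)} X^{L(w)}` in `ℤ[X]`. -/
noncomputable def signedDistribution (n : ℕ) (I : Finset ℕ) : ℤ[X] :=
  ∑ w ∈ quotient n (range n \ I), (-1) ^ len w * X ^ L w

/-- `(k)_q = 1 - q^k` for `k ≥ 1`, and `(0)_q = 1`. -/
def qn {R : Type*} [CommRing R] (q : R) (k : ℕ) : R := if k = 0 then 1 else 1 - q ^ k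

/-- `(n)_q! = (1)_q (2)_q ⋯ (n)_q`. -/
def qfact {R : Type*} [CommRing R] (q : R) (n : ℕ) : R := ∏ k ∈ Icc 1 n, qn q k

/-- For `I = {i_1 < ⋯ < i_l}`, `idx n I r` is `i_{r+1}` if `r < l`, and `n` if `r ≥ l`
(so that `i_{l+1} = n`, and `i_1 = n` if `I` is empty). -/
def idx (n : ℕ) (I : Finset ℕ) (r : ℕ) : ℕ :=
  if h : r < #I then I.orderEmbOfFin rfl ⟨r, h⟩ else n

/-- The field of fractions of `ℤ[X]`, in which the quotients of polynomials below are formed. -/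
abbrev Frac : Type := FractionRing ℤ[X]

/-- The indeterminate `X` as an element of the field of fractions. -/
noncomputable def x : Frac := algebraMap ℤ[X] Frac X

/-- `f_{n,I}(X) = (n)!/(i_1)! ∏_{r=1}^{l} ∏_{σ=1}^{⌊(i_{r+1}-i_r)/2⌋} (2σ)⁻¹`. -/
noncomputable def f (n : ℕ) (I : Finset ℕ) : Frac :=
  qfact x n / qfact x (idx n I 0) *
    ∏ r ∈ range #I, ∏ σ ∈ Icc 1 ((idx n I (r + 1) - idx n I r) / 2), (qn x (2 * σ))⁻¹

/-- The `q`-binomial coefficient `(a)_q! / ((a-b)_q! (b)_q!)`, for `b ≤ a`. -/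
def qbinom {K : Type*} [Field K] (q : K) (a b : ℕ) : K :=
  qfact q a / (qfact q (a - b) * qfact q b)

/-- The `q`-multinomial coefficient
`binom(n, i_l)_q binom(i_l, i_{l-1})_q ⋯ binom(i_2, i_1)_q` for `I = {i_1 < ⋯ < i_l}`. -/
def qmultinom {K : Type*} [Field K] (q : K) (n : ℕ) (I : Finset ℕ) : K :=
  ∏ r ∈ range #I, qbinom q (idx n I (r + 1)) (idx n I r)

/-- The number of pairs in the definition of `L` is even, so the division by two is exact. -/
theorem two_mul_L {n : ℕ} (w : B n) :
    2 * L w =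
      #{p : PM n × PM n | p.1.1 < p.2.1 ∧ (w.1 p.2).1 < (w.1 p.1).1 ∧ ¬ p.1.1 ≡ p.2.1 [ZMOD 2]} := by
  unfold L
  refine Nat.mul_div_cancel' ?_
  rw [← CharP.cast_eq_zero_iff (ZMod 2) 2, Finset.card_eq_sum_ones, Nat.cast_sum]
  refine Finset.sum_involution (fun p _ => (-p.2, -p.1)) ?_ ?_ ?_ ?_
  · intro p _
    decide
  · rintro ⟨a, b⟩ hp _ heq
    have h1 : (-b : PM n).1 = a.1 := congrArg Subtype.val (congrArg Prod.fst heq)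
    have h2 : -b.1 = a.1 := h1
    simp only [Finset.mem_filter, Int.modEq_iff_dvd] at hp
    exact hp.2.2.2 (by omega)
  · rintro ⟨a, b⟩ hp
    simp only [Finset.mem_filter, Finset.mem_univ, true_and, Int.modEq_iff_dvd] at hp ⊢
    obtain ⟨h1, h2, h3⟩ := hp
    have hab : a.1 < b.1 := h1
    have hw : (w.1 b).1 < (w.1 a).1 := h2
    refine ⟨show -b.1 < -a.1 by omega, ?_, ?_⟩
    · rw [w.2 a, w.2 b]
      exact show -(w.1 a).1 < -(w.1 b).1 by omega
    · change ¬ (2 : ℤ) ∣ -a.1 - -b.1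
      omega
  · rintro ⟨a, b⟩ _
    simp

end Hyperoctahedral

/-!
The formula holds for every `I`, and it is proved for all `I` at once in
`signedDistribution_eq_f`; the closed forms of `f` are then identities between products.

The Coxeter length of a signed permutation `w` is its number of inversions, counted over the pairs
`(i, j)` with `|i| < j`, and `L(w)` counts those inversions for which `i` and `j` have different
parities. So `(-1) ^ l(w) * X ^ L(w)` is a product over pairs of positions (`prod_rootFactor`),
and it makes sense for a window in which the positions carry arbitrary parities (`cellsWeight`).
The descents of `w` lie in `I` if and only if the window of `w`, cut after the positions in `I`,
consists of increasing blocks, the first of which has only positive values (`isWord_toWord_iff`).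

In an increasing block the value of largest absolute value `n` stands at the end if it is positive
and at the beginning if it is negative. Removing it leaves a word on `1, …, n - 1` of the same
kind, except that the parities of the positions no longer alternate along the whole window: they
alternate only inside each block. This gives a recursion for the weight sums (`sum_words_succ`).

The recursion has an explicit solution (`sum_cellsWeight`). Up to the product of the
`(k)` and `(2σ)` that also appears in `f`, the sum is `patternWeight`: reading the blocks from left
to right, every block of odd length must start with the parity that continues the alternation, or
else the sum vanishes, whereas a block of length `2k` which violates the alternation costs a factor
`X ^ k`. That this solves the recursion amounts to two telescoping sums, one over the ends and one
over the beginnings of the blocks (`sum_endTerm` and `sum_startTerm`). The blocks cut from an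
actual window respect the alternation, so that their `patternWeight` is `1`.
-/

namespace Hyperoctahedral

/-! ### Patterns of blocks and two telescoping sums -/

section Automaton

variable {R : Type*} [CommRing R] (q : R)

/-- The product of `-q ^ [ε ≠ e]` over `l` consecutive positions of alternating parities `ε`, the
first of which is `s`. Parities are encoded as Booleans, `true` for odd. -/
def blockPass (e : Bool) : Bool → ℕ → R
  | _, 0 => 1
  | s, l + 1 => -(if s = e then 1 else q) * blockPass e (!s) l

theorem blockPass_even (e s : Bool) (k : ℕ) : blockPass q e s (2 * k) = q ^ k := by
  induction k with
  | zero => simp [blockPass]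
  | succ k ih =>
    rw [show 2 * (k + 1) = 2 * k + 1 + 1 by ring, blockPass, blockPass, Bool.not_not, ih]
    cases e <;> cases s <;> simp <;> ring

theorem blockPass_odd (e s : Bool) (k : ℕ) :
    blockPass q e s (2 * k + 1) = -(if s = e then 1 else q) * q ^ k := by
  rw [blockPass, blockPass_even]

/-- The product of `blockPass` over a list of blocks, given by their initial parities and
lengths. -/
def pass (e : Bool) (st : List (Bool × ℕ)) : R :=
  (st.map fun b => blockPass q e b.1 b.2).prod

/-- The factor that a block of length `l` and initial parity `s` contributes to `patternWeight`
if the expected parity is `π`. -/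
def blockWeight (π s : Bool) (l : ℕ) : R :=
  if s = π then 1 else if l.bodd then 0 else q ^ (l / 2)

/-- The weight of a pattern of blocks with expected initial parity `π`. The expected parity is
the one that makes all positions alternate: it changes after each block of odd length. -/
def patternWeight : Bool → List (Bool × ℕ) → R
  | _, [] => 1
  | π, b :: st => blockWeight q π b.1 b.2 * patternWeight (π ^^ b.2.bodd) st

/-- The factor by which the reciprocal of `∏ σ ≤ l / 2, (2σ)` changes if `l` decreases by one;
it vanishes for `l = 0`. -/
def shrinkFactor (l : ℕ) : R := if l.bodd then 1 else 1 - q ^ l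

/-- The contribution of removing the last cell of block `r`: the removed value is positive, and it
is inverted with exactly the cells behind it. The remaining factors describe the pattern that is
left. -/
def endTerm (π : Bool) (st : List (Bool × ℕ)) (r : ℕ) : R :=
  match st.drop r with
  | [] => 0
  | b :: post => shrinkFactor q b.2 * pass q (b.1 ^^ (b.2 - 1).bodd) post *
      patternWeight q π (st.take r ++ (b.1, b.2 - 1) :: post)

/-- The contribution of removing the first cell of block `r`: the removed value `v` is negative;
every cell in front of it contributes twice, since it is both greater than `v` and has a negative
sum with `v`, and every cell behind it contributes once, through the negative sum. Here `u e` is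
the factor due to `v` itself and everything in front of the pattern, if the removed cell has
parity `e`. -/
def startTerm (u : Bool → R) (π : Bool) (st : List (Bool × ℕ)) (r : ℕ) : R :=
  match st.drop r with
  | [] => 0
  | b :: post => shrinkFactor q b.2 * (u b.1 * pass q b.1 (st.take r) ^ 2 *
      blockPass q b.1 (!b.1) (b.2 - 1) * pass q b.1 post) *
      patternWeight q π (st.take r ++ (!b.1, b.2 - 1) :: post)

theorem pass_nil (e : Bool) : pass q e [] = 1 := rfl

theorem pass_cons (e : Bool) (b : Bool × ℕ) (st : List (Bool × ℕ)) :
    pass q e (b :: st) = blockPass q e b.1 b.2 * pass q e st := by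
  simp [pass]

theorem endTerm_cons_succ (π : Bool) (b : Bool × ℕ) (st : List (Bool × ℕ)) (r : ℕ) :
    endTerm q π (b :: st) (r + 1) =
      blockWeight q π b.1 b.2 * endTerm q (π ^^ b.2.bodd) st r := by
  unfold endTerm
  rw [List.drop_succ_cons, List.take_succ_cons]
  cases st.drop r with
  | nil => simp
  | cons c post => simp only [List.cons_append, patternWeight]; ring

theorem startTerm_cons_succ (u : Bool → R) (π : Bool) (b : Bool × ℕ) (st : List (Bool × ℕ))
    (r : ℕ) :
    startTerm q u π (b :: st) (r + 1) = blockWeight q π b.1 b.2 *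
      startTerm q (fun e => u e * blockPass q e b.1 b.2 ^ 2) (π ^^ b.2.bodd) st r := by
  unfold startTerm
  rw [List.drop_succ_cons, List.take_succ_cons]
  cases st.drop r with
  | nil => simp
  | cons c post => simp only [List.cons_append, patternWeight, pass_cons]; ring

theorem eq_zero_or_odd_or_even (l : ℕ) :
    l = 0 ∨ (∃ k, l = 2 * k + 1) ∨ ∃ k, l = 2 * k + 1 + 1 := by
  rcases Nat.even_or_odd' l with ⟨k, rfl | rfl⟩
  · rcases k with _ | k
    · simp
    · exact .inr (.inr ⟨k, by ring⟩)
  · exact .inr (.inl ⟨k, rfl⟩)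

/-- Removing the last cell of a block in all possible ways: the contributions telescope. -/
theorem sum_endTerm (π : Bool) (st : List (Bool × ℕ)) :
    ∑ r ∈ range st.length, endTerm q π st r =
      patternWeight q π st - pass q (!π) st * patternWeight q (!π) st := by
  induction st generalizing π with
  | nil => simp [patternWeight, pass]
  | cons b st ih =>
    obtain ⟨s, l⟩ := b
    rw [List.length_cons, sum_range_succ']
    simp only [endTerm_cons_succ]
    rw [← mul_sum, ih]
    rcases eq_zero_or_odd_or_even l with rfl | ⟨k, rfl⟩ | ⟨k, rfl⟩
    · simp [endTerm, patternWeight, pass_cons, shrinkFactor, blockWeight, blockPass]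
    · cases π <;> cases s <;>
      simp [endTerm, patternWeight, pass_cons, shrinkFactor, blockWeight, blockPass_odd] <;> ring
    · have h : (2 * k + 1 + 1) / 2 = k + 1 := by omega
      have h' : 2 * k + 1 + 1 = 2 * (k + 1) := by ring
      have h3 := fun e s => blockPass_even q e s (k + 1)
      rw [← h'] at h3
      cases π <;> cases s <;>
      simp [endTerm, patternWeight, pass_cons, shrinkFactor, blockWeight, h, h3] <;> ring

/-- Removing the first cell of a block in all possible ways: the contributions telescope. The
hypotheses on `u` say that a cell of the expected parity `π` costs an extra factor `q`. They are
inherited by the remaining pattern, with `c` multiplied by `q ^ l`, when a first block of length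
`l` is split off; for odd `l` this needs that the block starts with the parity `π`, and otherwise
the block contributes the factor zero. -/
theorem sum_startTerm (c : R) (u : Bool → R) (π : Bool) (h₁ : u π = -(c * q)) (h₂ : u (!π) = -c)
    (st : List (Bool × ℕ)) :
    ∑ r ∈ range st.length, startTerm q u π st r =
      c * (pass q (!π) st * patternWeight q (!π) st -
        q ^ (st.map Prod.snd).sum * patternWeight q π st) := by
  induction st generalizing π u c with
  | nil => simp [patternWeight, pass]
  | cons b st ih =>
    obtain ⟨s, l⟩ := b
    rw [List.length_cons, sum_range_succ']
    simp only [startTerm_cons_succ]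
    rw [← mul_sum]
    rcases eq_zero_or_odd_or_even l with rfl | ⟨k, rfl⟩ | ⟨k, rfl⟩
    · rw [ih c]
      · simp [startTerm, patternWeight, pass_nil, pass_cons, shrinkFactor, blockWeight, blockPass]
      · simp [blockPass, h₁]
      · simp [blockPass, h₂]
    · by_cases hs : s = π
      · subst hs
        rw [ih (c * q ^ (2 * k + 1))]
        · cases s <;> simp at h₁ h₂ <;>
          simp [startTerm, patternWeight, pass_nil, pass_cons, shrinkFactor, blockWeight,
            blockPass_odd, blockPass_even, h₁] <;> ring
        · cases s <;> simp at h₂ <;> simp [blockPass_odd, h₂] <;> ring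
        · cases s <;> simp [blockPass_odd, h₁] <;> ring
      · -- A block of odd length with the wrong initial parity: only its own first cell counts.
        have : s = !π := by cases s <;> cases π <;> simp_all
        subst this
        cases π <;> simp at h₂ <;>
        simp [startTerm, patternWeight, pass_nil, pass_cons, shrinkFactor, blockWeight,
          blockPass_odd, blockPass_even, h₂] <;> ring
    · have h : (2 * k + 1 + 1) / 2 = k + 1 := by omega
      have h' : 2 * k + 1 + 1 = 2 * (k + 1) := by ring
      have h3 := fun e s => blockPass_even q e s (k + 1)
      rw [← h'] at h3
      rw [ih (c * q ^ (2 * k + 2))]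
      · cases π <;> cases s <;> simp at h₁ h₂ <;>
        simp [startTerm, patternWeight, pass_nil, pass_cons, shrinkFactor, blockWeight, h, h3,
          blockPass_odd, h₁, h₂] <;> ring
      · cases π <;> simp [h3, h₁] <;> ring
      · cases π <;> simp at h₂ <;> simp [h3, h₂] <;> ring

end Automaton

/-! ### Words and their signed weights -/

section Weights

variable {R : Type*} [CommRing R] (q : R)

/-- The contribution of a pair of cells, in this order, to the signed weight: a factor
`-q ^ [parities differ]` for each of the inversions `(i, j)` and `(-i, j)`. -/
def pairFactor (a b : Bool × ℤ) : R :=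
  (if b.2 < a.2 then -(if b.1 = a.1 then 1 else q) else 1) *
    if a.2 + b.2 < 0 then -(if b.1 = a.1 then 1 else q) else 1

/-- The contribution of a single cell to the signed weight, which comes from the pair `(0, j)`. -/
def cellFactor (a : Bool × ℤ) : R := if a.2 < 0 then -(if a.1 then q else 1) else 1

/-- The signed weight of a sequence of cells; a cell is a position, of which only the parity is
recorded, together with the value at this position. -/
def cellsWeight : List (Bool × ℤ) → R
  | [] => 1
  | a :: l => cellFactor q a * (l.map (pairFactor q a)).prod * cellsWeight l

/-- The product of `-q ^ [ε ≠ e]` over the parities `ε` of a sequence of cells. -/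
def cellsPass (e : Bool) (l : List (Bool × ℤ)) : R :=
  (l.map fun c => -(if c.1 = e then 1 else q)).prod

theorem cellsPass_append (e : Bool) (l₁ l₂ : List (Bool × ℤ)) :
    cellsPass q e (l₁ ++ l₂) = cellsPass q e l₁ * cellsPass q e l₂ := by
  simp [cellsPass]

theorem cellsPass_cons (e : Bool) (a : Bool × ℤ) (l : List (Bool × ℤ)) :
    cellsPass q e (a :: l) = -(if a.1 = e then 1 else q) * cellsPass q e l := by
  simp [cellsPass]

/-- Inserting a positive value that exceeds all other absolute values. -/
theorem cellsWeight_append_cons (e : Bool) (N : ℤ) (u v : List (Bool × ℤ))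
    (hu : ∀ c ∈ u, |c.2| < N) (hv : ∀ c ∈ v, |c.2| < N) (hN : 0 < N) :
    cellsWeight q (u ++ (e, N) :: v) = cellsWeight q (u ++ v) * cellsPass q e v := by
  induction u with
  | nil =>
    simp only [List.nil_append, cellsWeight, cellFactor, cellsPass]
    rw [if_neg (by omega), one_mul, mul_comm]
    congr 2
    refine List.map_congr_left fun c hc => ?_
    have := abs_lt.1 (hv c hc)
    simp only [pairFactor]
    rw [if_pos this.2, if_neg (show ¬N + c.2 < 0 by omega), mul_one]
  | cons a u ih =>
    have ha := abs_lt.1 (hu a (by simp))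
    have : pairFactor q a (e, N) = 1 := by
      simp only [pairFactor]
      rw [if_neg (show ¬N < a.2 by omega), if_neg (show ¬a.2 + N < 0 by omega), mul_one]
    simp only [List.cons_append, cellsWeight, List.map_append, List.map_cons, List.prod_append,
      List.prod_cons, this, ih fun c hc => hu c (by simp [hc])]
    ring

/-- Inserting a negative value that exceeds all others in absolute value. -/
theorem cellsWeight_append_neg_cons (e : Bool) (N : ℤ) (u v : List (Bool × ℤ))
    (hu : ∀ c ∈ u, |c.2| < N) (hv : ∀ c ∈ v, |c.2| < N) (hN : 0 < N) :
    cellsWeight q (u ++ (e, -N) :: v) = cellsWeight q (u ++ v) *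
      (-(if e then q else 1) * cellsPass q e u ^ 2 * cellsPass q e v) := by
  induction u with
  | nil =>
    simp only [List.nil_append, cellsWeight, cellFactor]
    rw [if_pos (by omega), mul_comm]
    congr 1
    rw [show cellsPass q e [] = 1 from rfl, one_pow, mul_one, cellsPass]
    congr 2
    refine List.map_congr_left fun c hc => ?_
    have := abs_lt.1 (hv c hc)
    simp only [pairFactor]
    rw [if_neg (show ¬c.2 < -N by omega), if_pos (show -N + c.2 < 0 by omega), one_mul]
  | cons a u ih =>
    have ha := abs_lt.1 (hu a (by simp))
    have : pairFactor q a (e, -N) = (-(if a.1 = e then 1 else q)) ^ 2 := by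
      simp only [pairFactor]
      rw [if_pos ha.1, if_pos (show a.2 + -N < 0 by omega), sq]
      simp only [eq_comm (a := e)]
    simp only [List.cons_append, cellsWeight, List.map_append, List.map_cons, List.prod_append,
      List.prod_cons, this, ih fun c hc => hu c (by simp [hc]), cellsPass_cons]
    ring

/-- The cells of a block with initial parity `s`: the parities alternate. -/
def blockCells : Bool → List ℤ → List (Bool × ℤ)
  | _, [] => []
  | s, v :: l => (s, v) :: blockCells (!s) l

theorem blockCells_append (s : Bool) (l₁ l₂ : List ℤ) :
    blockCells s (l₁ ++ l₂) = blockCells s l₁ ++ blockCells (s ^^ l₁.length.bodd) l₂ := by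
  induction l₁ generalizing s with
  | nil => simp [blockCells]
  | cons v l ih => simp [blockCells, ih]

theorem snd_mem_of_mem_blockCells {s : Bool} {l : List ℤ} {c : Bool × ℤ}
    (h : c ∈ blockCells s l) : c.2 ∈ l := by
  induction l generalizing s with
  | nil => simp [blockCells] at h
  | cons v l ih =>
    rcases List.mem_cons.1 h with rfl | h
    · simp
    · exact List.mem_cons_of_mem _ (ih h)

theorem cellsPass_blockCells (e s : Bool) (l : List ℤ) :
    cellsPass q e (blockCells s l) = blockPass q e s l.length := by
  induction l generalizing s with
  | nil => rfl
  | cons v l ih => simp only [blockCells, cellsPass_cons, ih, List.length_cons, blockPass]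

/-- A block consists of a flag which tells whether its values have to be positive, the parity of
its first position, and its values. -/
abbrev Block : Type := Bool × Bool × List ℤ

/-- The cells of a list of blocks. -/
def wordCells (x : List Block) : List (Bool × ℤ) := x.flatMap fun b => blockCells b.2.1 b.2.2

/-- The shape of a list of blocks remembers only the lengths of the blocks. -/
def shape (x : List Block) : List (Bool × Bool × ℕ) := x.map fun b => (b.1, b.2.1, b.2.2.length)

/-- The version of `pass` for shapes with flags. -/
def shapePass (e : Bool) (sh : List (Bool × Bool × ℕ)) : R :=
  (sh.map fun b => blockPass q e b.2.1 b.2.2).prod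

theorem cellsPass_wordCells (e : Bool) (x : List Block) :
    cellsPass q e (wordCells x) = shapePass q e (shape x) := by
  induction x with
  | nil => rfl
  | cons b x ih =>
    simp only [wordCells, shapePass, shape] at ih
    simp [wordCells, shapePass, shape, cellsPass_append, cellsPass_blockCells, ih]

/-- Append the value `N` to a block. -/
def insEnd (N : ℤ) (b : Block) : Block := (b.1, b.2.1, b.2.2 ++ [N])

/-- Put the value `-N` in front of a block. The other values of the block keep the parities of
their positions, so the initial parity changes. -/
def insStart (N : ℤ) (b : Block) : Block := (b.1, !b.2.1, -N :: b.2.2)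

theorem modify_append_cons {α : Type*} (pre : List α) (c : α) (post : List α) (g : α → α) :
    (pre ++ c :: post).modify pre.length g = pre ++ g c :: post := by
  induction pre with
  | nil => rfl
  | cons a pre ih => simp [ih]

theorem exists_eq_of_shape_eq {x : List Block} {pre post : List (Bool × Bool × ℕ)} {p s : Bool}
    {l : ℕ} (hx : shape x = pre ++ (p, s, l) :: post) :
    ∃ y v z, x = y ++ (p, s, v) :: z ∧ shape y = pre ∧ v.length = l ∧ shape z = post ∧
      y.length = pre.length := by
  obtain ⟨y, t, rfl, hy, ht⟩ := List.map_eq_append_iff.1 hx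
  obtain ⟨b, z, rfl, hb, hz⟩ := List.map_eq_cons_iff.1 ht
  obtain ⟨p', s', v⟩ := b
  simp only [Prod.mk.injEq] at hb
  obtain ⟨rfl, rfl, hl⟩ := hb
  exact ⟨y, v, z, rfl, hy, hl, hz, by simp [← hy]⟩

theorem snd_mem_of_mem_wordCells {x : List Block} {c : Bool × ℤ} (h : c ∈ wordCells x) :
    ∃ b ∈ x, c.2 ∈ b.2.2 := by
  obtain ⟨b, hb, hc⟩ := List.mem_flatMap.1 h
  exact ⟨b, hb, snd_mem_of_mem_blockCells hc⟩

theorem cellsWeight_modify_insEnd {x : List Block} {pre post : List (Bool × Bool × ℕ)}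
    {p s : Bool} {l : ℕ} (hx : shape x = pre ++ (p, s, l) :: post) {N : ℤ} (hN : 0 < N)
    (hlt : ∀ b ∈ x, ∀ v ∈ b.2.2, |v| < N) :
    cellsWeight q (wordCells (x.modify pre.length (insEnd N))) =
      cellsWeight q (wordCells x) * shapePass q (s ^^ l.bodd) post := by
  obtain ⟨y, v, z, rfl, rfl, rfl, rfl, hlen⟩ := exists_eq_of_shape_eq hx
  rw [← hlen, modify_append_cons, ← cellsPass_wordCells]
  have hb : ∀ c ∈ wordCells (y ++ (p, s, v) :: z), |c.2| < N := fun c hc => by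
    obtain ⟨b, hb, hc⟩ := snd_mem_of_mem_wordCells hc
    exact hlt b hb _ hc
  simp only [wordCells, List.flatMap_append, List.flatMap_cons, insEnd, blockCells_append,
    blockCells] at hb ⊢
  simp only [List.append_assoc, List.singleton_append]
  rw [← List.append_assoc, cellsWeight_append_cons, List.append_assoc]
  · intro c hc
    exact hb c (by simp only [List.mem_append] at hc ⊢; tauto)
  · intro c hc
    exact hb c (by simp only [List.mem_append] at hc ⊢; tauto)
  · exact hN

theorem cellsWeight_modify_insStart {x : List Block} {pre post : List (Bool × Bool × ℕ)}
    {p s : Bool} {l : ℕ} (hx : shape x = pre ++ (p, !s, l) :: post) {N : ℤ} (hN : 0 < N)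
    (hlt : ∀ b ∈ x, ∀ v ∈ b.2.2, |v| < N) :
    cellsWeight q (wordCells (x.modify pre.length (insStart N))) =
      cellsWeight q (wordCells x) * (-(if s then q else 1) * shapePass q s pre ^ 2 *
        (blockPass q s (!s) l * shapePass q s post)) := by
  obtain ⟨y, v, z, rfl, rfl, rfl, rfl, hlen⟩ := exists_eq_of_shape_eq hx
  rw [← hlen, modify_append_cons, ← cellsPass_wordCells, ← cellsPass_wordCells,
    ← cellsPass_blockCells, ← cellsPass_append]
  have hb : ∀ c ∈ wordCells (y ++ (p, !s, v) :: z), |c.2| < N := fun c hc => by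
    obtain ⟨b, hb, hc⟩ := snd_mem_of_mem_wordCells hc
    exact hlt b hb _ hc
  simp only [wordCells, List.flatMap_append, List.flatMap_cons, insStart, blockCells,
    Bool.not_not] at hb ⊢
  rw [List.cons_append, cellsWeight_append_neg_cons]
  · intro c hc
    exact hb c (by simp only [List.mem_append] at hc ⊢; tauto)
  · intro c hc
    exact hb c (by simp only [List.mem_append] at hc ⊢; tauto)
  · exact hN

end Weights

/-- The words of a given shape on the values `1, …, n`: each of these values occurs exactly once
up to sign, the blocks are increasing, and the values of flagged blocks are positive. -/
structure IsWord (n : ℕ) (sh : List (Bool × Bool × ℕ)) (x : List Block) : Prop where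
  shape_eq : shape x = sh
  sorted : ∀ b ∈ x, b.2.2.Pairwise (· < ·)
  pos : ∀ b ∈ x, b.1 = true → ∀ v ∈ b.2.2, 0 < v
  perm : ((x.flatMap fun b => b.2.2).map Int.natAbs).Perm (List.range' 1 n)

/-- The words of a given shape which arise from smaller words by inserting `±(n + 1)` into block
`r`. -/
def insertions (W : List (Bool × Bool × ℕ) → Finset (List Block)) (n : ℕ)
    (sh : List (Bool × Bool × ℕ)) (r : ℕ) : Finset (List Block) :=
  match sh.drop r with
  | [] => ∅
  | c :: post => if c.2.2 = 0 then ∅ else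
      (W (sh.take r ++ (c.1, c.2.1, c.2.2 - 1) :: post)).image (·.modify r (insEnd (n + 1))) ∪
      if c.1 then ∅ else
        (W (sh.take r ++ (c.1, !c.2.1, c.2.2 - 1) :: post)).image (·.modify r (insStart (n + 1)))

/-- The finite set of all words, built by inserting the values in increasing order of absolute
value. -/
def words : ℕ → List (Bool × Bool × ℕ) → Finset (List Block)
  | 0, sh => if ∀ c ∈ sh, c.2.2 = 0 then {sh.map fun c => (c.1, c.2.1, [])} else ∅
  | n + 1, sh => (range sh.length).biUnion (insertions (words n) n sh)

theorem IsWord.natAbs_le {n : ℕ} {sh : List (Bool × Bool × ℕ)} {x : List Block}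
    (h : IsWord n sh x) {b : Block} (hb : b ∈ x) {v : ℤ} (hv : v ∈ b.2.2) :
    1 ≤ v.natAbs ∧ v.natAbs ≤ n := by
  have : v.natAbs ∈ (x.flatMap fun b => b.2.2).map Int.natAbs :=
    List.mem_map_of_mem (List.mem_flatMap.2 ⟨b, hb, hv⟩)
  have := (h.perm.mem_iff).1 this
  simp only [List.mem_range'_1] at this
  omega

theorem IsWord.insEnd {n : ℕ} {pre post : List (Bool × Bool × ℕ)} {p s : Bool} {l : ℕ}
    {x : List Block} (h : IsWord n (pre ++ (p, s, l) :: post) x) :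
    IsWord (n + 1) (pre ++ (p, s, l + 1) :: post)
      (x.modify pre.length (insEnd (n + 1))) := by
  obtain ⟨y, v, z, rfl, rfl, rfl, rfl, hlen⟩ := exists_eq_of_shape_eq h.shape_eq
  have hle := fun b hb v hv => h.natAbs_le (b := b) hb (v := v) hv
  rw [← hlen, modify_append_cons]
  obtain ⟨-, h2, h3, h4⟩ := h
  simp only [List.forall_mem_append, List.forall_mem_cons] at h2 h3 hle
  refine ⟨by simp [shape, Hyperoctahedral.insEnd], ?_, ?_, ?_⟩
  · simp only [List.forall_mem_append, List.forall_mem_cons]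
    refine ⟨h2.1, ?_, h2.2.2⟩
    simp only [Hyperoctahedral.insEnd, List.pairwise_append, List.pairwise_singleton]
    refine ⟨h2.2.1, trivial, fun a ha b hb => ?_⟩
    have := hle.2.1 a ha
    simp only [List.mem_singleton] at hb
    omega
  · simp only [List.forall_mem_append, List.forall_mem_cons]
    refine ⟨h3.1, fun hp a ha => ?_, h3.2.2⟩
    rcases List.mem_append.1 ha with ha | ha
    · exact h3.2.1 hp a ha
    · simp only [List.mem_singleton] at ha
      omega
  · have e : ((n : ℤ) + 1).natAbs = n + 1 := by omega
    simp only [List.flatMap_append, List.flatMap_cons, List.map_append, Hyperoctahedral.insEnd,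
      List.map_cons, e, List.append_assoc, List.singleton_append] at h4 ⊢
    rw [List.range'_concat, ← List.append_assoc, one_mul, add_comm 1 n]
    rw [← List.append_assoc] at h4
    exact List.perm_middle.trans ((h4.cons _).trans (List.perm_append_singleton _ _).symm)

theorem IsWord.insStart {n : ℕ} {pre post : List (Bool × Bool × ℕ)} {s : Bool} {l : ℕ}
    {x : List Block} (h : IsWord n (pre ++ (false, !s, l) :: post) x) :
    IsWord (n + 1) (pre ++ (false, s, l + 1) :: post)
      (x.modify pre.length (insStart (n + 1))) := by
  obtain ⟨y, v, z, rfl, rfl, rfl, rfl, hlen⟩ := exists_eq_of_shape_eq h.shape_eq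
  have hle := fun b hb v hv => h.natAbs_le (b := b) hb (v := v) hv
  rw [← hlen, modify_append_cons]
  obtain ⟨-, h2, h3, h4⟩ := h
  simp only [List.forall_mem_append, List.forall_mem_cons] at h2 h3 hle
  refine ⟨by simp [shape, Hyperoctahedral.insStart], ?_, ?_, ?_⟩
  · simp only [List.forall_mem_append, List.forall_mem_cons]
    refine ⟨h2.1, ?_, h2.2.2⟩
    simp only [Hyperoctahedral.insStart, List.pairwise_cons]
    refine ⟨fun a ha => ?_, h2.2.1⟩
    have := hle.2.1 a ha
    omega
  · simp only [List.forall_mem_append, List.forall_mem_cons]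
    exact ⟨h3.1, fun hp => by simp [Hyperoctahedral.insStart] at hp, h3.2.2⟩
  · have e : (-((n : ℤ) + 1)).natAbs = n + 1 := by omega
    simp only [List.flatMap_append, List.flatMap_cons, List.map_append, Hyperoctahedral.insStart,
      List.map_cons, e, List.cons_append] at h4 ⊢
    rw [List.range'_concat, one_mul, add_comm 1 n]
    exact List.perm_middle.trans ((h4.cons _).trans (List.perm_append_singleton _ _).symm)

/-- The value of largest absolute value stands at one of the ends of its block. -/
theorem IsWord.exists_eq_insert {n : ℕ} {sh : List (Bool × Bool × ℕ)} {x : List Block}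
    (h : IsWord (n + 1) sh x) :
    ∃ pre p s l post, sh = pre ++ (p, s, l + 1) :: post ∧
      ((∃ x', IsWord n (pre ++ (p, s, l) :: post) x' ∧
        x = x'.modify pre.length (Hyperoctahedral.insEnd (n + 1))) ∨
      (p = false ∧ ∃ x', IsWord n (pre ++ (p, !s, l) :: post) x' ∧
        x = x'.modify pre.length (Hyperoctahedral.insStart (n + 1)))) := by
  have hmem : n + 1 ∈ (x.flatMap fun b => b.2.2).map Int.natAbs :=
    h.perm.mem_iff.2 (by simp only [List.mem_range'_1]; omega)
  obtain ⟨N, hN, hNn⟩ := List.mem_map.1 hmem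
  obtain ⟨⟨p, s, v⟩, hb, hv⟩ := List.mem_flatMap.1 hN
  obtain ⟨y, z, rfl⟩ := List.append_of_mem hb
  obtain ⟨u, w, rfl⟩ := List.append_of_mem hv
  have hle := fun b hb v hv => h.natAbs_le (b := b) hb (v := v) hv
  obtain ⟨rfl, h2, h3, h4⟩ := h
  simp only [List.forall_mem_append, List.forall_mem_cons] at h2 h3 hle
  obtain ⟨h2a, h2b, h2c⟩ := h2
  obtain ⟨h3a, h3b, h3c⟩ := h3
  obtain ⟨hla, ⟨hlu, hlN, hlw⟩, hlc⟩ := hle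
  simp only [List.pairwise_append, List.pairwise_cons, List.mem_cons] at h2b
  obtain ⟨hu, ⟨hw1, hw⟩, huw⟩ := h2b
  have e : ((n : ℤ) + 1).natAbs = n + 1 := by omega
  simp only [List.flatMap_append, List.flatMap_cons, List.map_append, List.map_cons, hNn,
    List.append_assoc, List.cons_append] at h4
  rw [List.range'_concat, one_mul, add_comm 1 n, ← List.append_assoc] at h4
  replace h4 := (List.perm_cons _).1
    (List.perm_middle.symm.trans (h4.trans (List.perm_append_singleton _ _)))
  rcases Int.natAbs_eq N with hN' | hN' <;> rw [hNn] at hN' <;> push_cast at hN'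
  · have : w = [] := by
      rcases w with _ | ⟨a, w⟩
      · rfl
      · have h1 := hw1 a (by simp)
        have h2 := hlw a (by simp)
        omega
    subst this hN'
    refine ⟨shape y, p, s, u.length, shape z, by simp [shape], .inl ⟨y ++ (p, s, u) :: z, ?_, ?_⟩⟩
    · refine ⟨by simp [shape], ?_, ?_, ?_⟩
      · simp only [List.forall_mem_append, List.forall_mem_cons]
        exact ⟨h2a, hu, h2c⟩
      · simp only [List.forall_mem_append, List.forall_mem_cons]
        exact ⟨h3a, fun hp => (h3b hp).1, h3c⟩
      · simpa using h4
    · rw [show (shape y).length = y.length by simp [shape], modify_append_cons]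
      rfl
  · have : u = [] := by
      rcases u with _ | ⟨a, u⟩
      · rfl
      · have h1 := huw a (by simp) N (by simp)
        have h2 := hlu a (by simp)
        omega
    subst this hN'
    have hp : p = false := by
      by_contra hp
      have := (h3b (by simpa using hp)).2.1
      omega
    subst hp
    refine ⟨shape y, false, s, w.length, shape z, by simp [shape],
      .inr ⟨rfl, y ++ (false, !s, w) :: z, ?_, ?_⟩⟩
    · refine ⟨by simp [shape], ?_, ?_, ?_⟩
      · simp only [List.forall_mem_append, List.forall_mem_cons]
        exact ⟨h2a, hw, h2c⟩
      · simp only [List.forall_mem_append, List.forall_mem_cons]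
        exact ⟨h3a, fun hp => by simp at hp, h3c⟩
      · simpa using h4
    · rw [show (shape y).length = y.length by simp [shape], modify_append_cons]
      simp [Hyperoctahedral.insStart]

theorem mem_insertions {W : List (Bool × Bool × ℕ) → Finset (List Block)} {n r : ℕ}
    {sh : List (Bool × Bool × ℕ)} {x : List Block} :
    x ∈ insertions W n sh r ↔ ∃ pre p s l post, sh = pre ++ (p, s, l + 1) :: post ∧
      pre.length = r ∧ ((∃ x' ∈ W (pre ++ (p, s, l) :: post),
        x = x'.modify pre.length (insEnd (n + 1))) ∨
      (p = false ∧ ∃ x' ∈ W (pre ++ (p, !s, l) :: post),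
        x = x'.modify pre.length (insStart (n + 1)))) := by
  constructor
  · intro h
    unfold insertions at h
    rcases hd : sh.drop r with _ | ⟨⟨p, s, l⟩, post⟩
    · simp [hd] at h
    · have hr : r < sh.length := by
        by_contra hr
        rw [List.drop_eq_nil_of_le (by omega)] at hd
        cases hd
      have hlen : (sh.take r).length = r := by simp; omega
      rcases l with _ | l
      · simp [hd] at h
      · refine ⟨sh.take r, p, s, l, post, ?_, hlen, ?_⟩
        · rw [← hd, List.take_append_drop]
        · rw [hlen]
          simp only [hd, Nat.add_eq_zero_iff, one_ne_zero, and_false, if_false, mem_union,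
            mem_image, Nat.add_sub_cancel] at h
          rcases h with ⟨x', hx', rfl⟩ | h
          · exact .inl ⟨x', hx', rfl⟩
          · cases p
            · simp only [Bool.false_eq_true, if_false, mem_image] at h
              obtain ⟨x', hx', rfl⟩ := h
              exact .inr ⟨rfl, x', hx', rfl⟩
            · simp at h
  · rintro ⟨pre, p, s, l, post, rfl, rfl, h⟩
    unfold insertions
    simp only [List.drop_left, List.take_left, Nat.add_eq_zero_iff, one_ne_zero, and_false,
      if_false, Nat.add_sub_cancel, mem_union, mem_image]
    rcases h with ⟨x', hx', rfl⟩ | ⟨rfl, x', hx', rfl⟩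
    · exact .inl ⟨x', hx', rfl⟩
    · right
      simp only [Bool.false_eq_true, if_false, mem_image]
      exact ⟨x', hx', rfl⟩

theorem mem_words {n : ℕ} {sh : List (Bool × Bool × ℕ)} {x : List Block} :
    x ∈ words n sh ↔ IsWord n sh x := by
  induction n generalizing sh x with
  | zero =>
    rw [words]
    constructor
    · intro h
      split_ifs at h with h0
      · rw [mem_singleton] at h
        subst h
        have h1 : ∀ b ∈ sh.map fun c => ((c.1, c.2.1, []) : Block), b.2.2 = [] := fun b hb => by
          obtain ⟨c, -, rfl⟩ := List.mem_map.1 hb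
          rfl
        refine ⟨?_, fun b hb => by simp [h1 b hb], fun b hb => by simp [h1 b hb],
          by simp [List.flatMap_map]⟩
        simp only [shape, List.map_map]
        refine (List.map_congr_left fun c hc => ?_).trans (List.map_id sh)
        simp [← h0 c hc]
      · simp at h
    · rintro ⟨rfl, -, -, h⟩
      have h0 : ∀ b ∈ x, b.2.2 = [] := by
        have : (x.flatMap fun b => b.2.2) = [] := by simpa using h
        simpa [List.flatMap_eq_nil_iff] using this
      rw [if_pos, mem_singleton]
      · simp only [shape, List.map_map]
        refine (List.map_id x).symm.trans (List.map_congr_left fun b hb => ?_)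
        simp [← h0 b hb]
      · intro c hc
        obtain ⟨b, hb, rfl⟩ := List.mem_map.1 hc
        simp [h0 b hb]
  | succ n ih =>
    simp only [words, mem_biUnion, mem_range, mem_insertions, ih]
    constructor
    · rintro ⟨r, hr, pre, p, s, l, post, rfl, rfl, ⟨x', hx', rfl⟩ | ⟨rfl, x', hx', rfl⟩⟩
      · exact hx'.insEnd
      · exact hx'.insStart
    · intro h
      obtain ⟨pre, p, s, l, post, rfl, h'⟩ := h.exists_eq_insert
      exact ⟨pre.length, by simp, pre, p, s, l, post, rfl, rfl, h'⟩

theorem modify_injective {α : Type*} {g : α → α} (hg : Function.Injective g) (r : ℕ) :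
    Function.Injective fun x : List α => x.modify r g := by
  intro x y h
  refine List.ext_getElem? fun j => ?_
  have := congrArg (·[j]?) h
  simp only [List.getElem?_modify] at this
  refine Option.map_injective (f := fun a => if r = j then g a else a) ?_ this
  split_ifs
  · exact hg
  · exact fun _ _ h => h

theorem insEnd_injective (N : ℤ) : Function.Injective (insEnd N) := by
  rintro ⟨p, s, v⟩ ⟨p', s', v'⟩ h
  simpa [insEnd] using h

theorem insStart_injective (N : ℤ) : Function.Injective (insStart N) := by
  rintro ⟨p, s, v⟩ ⟨p', s', v'⟩ h
  simpa [insStart] using h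

theorem disjoint_insertions (n : ℕ) (sh : List (Bool × Bool × ℕ)) {r r' : ℕ} (hr : r ≠ r') :
    Disjoint (insertions (words n) n sh r) (insertions (words n) n sh r') := by
  have key : ∀ r x, x ∈ insertions (words n) n sh r →
      (∃ b, x[r]? = some b ∧ ∃ v ∈ b.2.2, v.natAbs = n + 1) ∧
      ∀ j, j ≠ r → ∀ b, x[j]? = some b → ∀ v ∈ b.2.2, v.natAbs ≤ n := by
    intro r x hx
    rw [mem_insertions] at hx
    obtain ⟨pre, p, s, l, post, -, rfl, ⟨x', hx', rfl⟩ | ⟨-, x', hx', rfl⟩⟩ := hx <;>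
    rw [mem_words] at hx' <;>
    obtain ⟨y, v, z, rfl, -, -, -, hlen⟩ := exists_eq_of_shape_eq hx'.shape_eq <;>
    refine ⟨?_, fun j hj b hb v hv => ?_⟩
    · rw [← hlen, modify_append_cons]
      exact ⟨_, by rw [List.getElem?_append_right le_rfl, Nat.sub_self]; rfl,
        (n : ℤ) + 1, by simp [insEnd], by omega⟩
    · simp only [List.getElem?_modify, if_neg (Ne.symm hj), Option.map_eq_map, Option.map_id'] at hb
      exact (hx'.natAbs_le (List.mem_of_getElem? hb) hv).2
    · rw [← hlen, modify_append_cons]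
      exact ⟨_, by rw [List.getElem?_append_right le_rfl, Nat.sub_self]; rfl,
        -((n : ℤ) + 1), by simp [insStart], by omega⟩
    · simp only [List.getElem?_modify, if_neg (Ne.symm hj), Option.map_eq_map, Option.map_id'] at hb
      exact (hx'.natAbs_le (List.mem_of_getElem? hb) hv).2
  rw [Finset.disjoint_left]
  intro x hx hx'
  obtain ⟨⟨b, hb, v, hv, hvn⟩, -⟩ := key r x hx
  have := (key r' x hx').2 r hr b hb v hv
  omega

/-- Sums over words are evaluated by removing the value of largest absolute value. -/
theorem sum_words_succ {M : Type*} [AddCommMonoid M] (n : ℕ) (sh : List (Bool × Bool × ℕ))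
    (Φ : List Block → M) :
    ∑ x ∈ words (n + 1) sh, Φ x =
      ∑ r ∈ range sh.length, ∑ x ∈ insertions (words n) n sh r, Φ x := by
  rw [words, sum_biUnion]
  intro r _ r' _ hr
  exact disjoint_insertions n sh hr

theorem sum_insertions {M : Type*} [AddCommMonoid M] (n : ℕ) (pre post : List (Bool × Bool × ℕ))
    (p s : Bool) (l : ℕ) (Φ : List Block → M) :
    ∑ x ∈ insertions (words n) n (pre ++ (p, s, l + 1) :: post) pre.length, Φ x =
      (∑ x ∈ words n (pre ++ (p, s, l) :: post), Φ (x.modify pre.length (insEnd (n + 1)))) +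
      if p then 0 else
        ∑ x ∈ words n (pre ++ (p, !s, l) :: post), Φ (x.modify pre.length (insStart (n + 1))) := by
  simp only [insertions, List.drop_left, List.take_left, Nat.add_eq_zero_iff, one_ne_zero,
    and_false, if_false, Nat.add_sub_cancel]
  rw [sum_union]
  · rw [sum_image ((modify_injective (insEnd_injective _) _).injOn)]
    cases p
    · simp only [Bool.false_eq_true, if_false]
      rw [sum_image ((modify_injective (insStart_injective _) _).injOn)]
    · simp
  · cases p
    swap
    · simp
    rw [Finset.disjoint_left]
    simp only [Bool.false_eq_true, if_false, mem_image, mem_words]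
    rintro x ⟨x₁, h₁, rfl⟩ ⟨x₂, h₂, h⟩
    obtain ⟨y₁, v₁, z₁, rfl, -, -, -, hl₁⟩ := exists_eq_of_shape_eq h₁.shape_eq
    obtain ⟨y₂, v₂, z₂, rfl, -, -, -, hl₂⟩ := exists_eq_of_shape_eq h₂.shape_eq
    have h' := h
    rw [← hl₁, modify_append_cons, hl₁, ← hl₂, modify_append_cons] at h'
    have h3 := (List.append_inj h' (hl₂.trans hl₁.symm)).2
    simp only [insStart, insEnd, List.cons.injEq, Prod.mk.injEq] at h3
    have h4 : -((n : ℤ) + 1) ∈ v₁ ++ [(n : ℤ) + 1] := by rw [← h3.1.2.2]; simp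
    rcases List.mem_append.1 h4 with h4 | h4
    · have := h₁.natAbs_le (b := (false, s, v₁)) (by simp) h4
      omega
    · simp only [List.mem_singleton] at h4
      omega

/-! ### Evaluation of the weight sums -/

section Evaluation

variable {K : Type*} [Field K] (q : K)

/-- The shape with a flagged first block of length `b`, which starts at the position `1`, and
further blocks `st`, which are not flagged. -/
def flaggedShape (b : ℕ) (st : List (Bool × ℕ)) : List (Bool × Bool × ℕ) :=
  (true, true, b) :: st.map fun c => (false, c)

/-- The product `∏ σ ≤ l / 2, (2σ)` in the denominator of `f`. -/
def blockDen (l : ℕ) : K := ∏ σ ∈ Icc 1 (l / 2), qn q (2 * σ)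

/-- The closed form of the signed weight sum over the words of shape `flaggedShape b st`, see
`sum_cellsWeight`. -/
def wordSum (b : ℕ) (st : List (Bool × ℕ)) : K :=
  qfact q (b + (st.map Prod.snd).sum) / qfact q b * (st.map fun c => (blockDen q c.2)⁻¹).prod *
    patternWeight q (true ^^ b.bodd) st

theorem qfact_succ (n : ℕ) : qfact q (n + 1) = qfact q n * (1 - q ^ (n + 1)) := by
  rw [qfact, Finset.prod_Icc_succ_top (by omega)]
  simp [qfact, qn]

theorem qfact_ne_zero (hq : ∀ k, qn q k ≠ 0) (n : ℕ) : qfact q n ≠ 0 :=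
  prod_ne_zero_iff.2 fun k _ => hq k

theorem shapePass_map (e : Bool) (st : List (Bool × ℕ)) :
    shapePass q e (st.map fun c => (false, c)) = pass q e st := by
  simp [shapePass, pass, Function.comp_def]

theorem shapePass_cons (e : Bool) (c : Bool × Bool × ℕ) (sh : List (Bool × Bool × ℕ)) :
    shapePass q e (c :: sh) = blockPass q e c.2.1 c.2.2 * shapePass q e sh := by
  simp [shapePass]

theorem inv_blockDen (hq : ∀ k, qn q k ≠ 0) (l : ℕ) :
    (blockDen q l)⁻¹ = (blockDen q (l + 1))⁻¹ * shrinkFactor q (l + 1) := by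
  rcases Nat.even_or_odd' l with ⟨k, rfl | rfl⟩
  · have : (2 * k + 1) / 2 = 2 * k / 2 := by omega
    simp [blockDen, shrinkFactor, this]
  · have h1 : (2 * k + 1 + 1) / 2 = k + 1 := by omega
    have h2 : (2 * k + 1) / 2 = k := by omega
    have h3 := hq (2 * (k + 1))
    have h4 : qn q (2 * (k + 1)) = 1 - q ^ (2 * k + 1 + 1) := by
      simp [qn, mul_add, add_assoc]
    rw [blockDen, blockDen, h1, h2, Finset.prod_Icc_succ_top (by omega), mul_inv, mul_assoc]
    simp only [shrinkFactor, Nat.bodd_succ, Nat.bodd_mul, Nat.bodd_zero, Bool.not_true,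
      Bool.not_false, Bool.false_and, Bool.false_eq_true, if_false]
    rw [← h4, inv_mul_cancel₀ h3, mul_one]

theorem insertions_of_length_eq_zero (W : List (Bool × Bool × ℕ) → Finset (List Block)) (n : ℕ)
    (pre post : List (Bool × Bool × ℕ)) (p s : Bool) :
    insertions W n (pre ++ (p, s, 0) :: post) pre.length = ∅ := by
  simp [insertions]

theorem abs_lt_of_mem_words {n : ℕ} {sh : List (Bool × Bool × ℕ)} {x : List Block}
    (hx : x ∈ words n sh) : ∀ b ∈ x, ∀ v ∈ b.2.2, |v| < (n : ℤ) + 1 := by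
  intro b hb v hv
  have := (mem_words.1 hx).natAbs_le hb hv
  rw [Int.abs_eq_natAbs]
  omega

/-- Inserting the largest value into the flagged block. -/
theorem sum_insertions_flagged (hq : ∀ k, qn q k ≠ 0) {n b : ℕ} {st : List (Bool × ℕ)}
    (hn : b + (st.map Prod.snd).sum = n + 1)
    (ih : ∀ b st, b + (st.map Prod.snd).sum = n →
      ∑ x ∈ words n (flaggedShape b st), cellsWeight q (wordCells x) = wordSum q b st) :
    ∑ x ∈ insertions (words n) n (flaggedShape b st) 0, cellsWeight q (wordCells x) =
      qfact q n / qfact q b * (st.map fun c => (blockDen q c.2)⁻¹).prod *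
        ((1 - q ^ b) * (pass q (!(true ^^ b.bodd)) st *
          patternWeight q (!(true ^^ b.bodd)) st)) := by
  rcases b with _ | b
  · have := insertions_of_length_eq_zero (words n) n [] (st.map fun c => (false, c)) true true
    simp only [List.nil_append, List.length_nil] at this
    simp [flaggedShape, this]
  · have := sum_insertions n [] (st.map fun c => (false, c)) true true b
      (fun x => cellsWeight q (wordCells x))
    simp only [List.nil_append, List.length_nil, if_true, add_zero] at this
    rw [flaggedShape, this]
    have h : ∀ x ∈ words n ((true, true, b) :: st.map fun c => (false, c)),
        cellsWeight q (wordCells (x.modify 0 (insEnd (n + 1)))) =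
          cellsWeight q (wordCells x) * pass q (true ^^ b.bodd) st := fun x hx => by
      rw [← shapePass_map]
      exact cellsWeight_modify_insEnd q (pre := []) (mem_words.1 hx).shape_eq (by omega)
        (abs_lt_of_mem_words hx)
    rw [sum_congr rfl h, ← sum_mul]
    have hn' : b + (st.map Prod.snd).sum = n := by omega
    rw [← flaggedShape, ih _ _ hn', wordSum, hn', qfact_succ]
    have h1 := hq (b + 1)
    simp only [qn, Nat.add_eq_zero_iff, one_ne_zero, and_false, if_false] at h1
    have h2 := qfact_ne_zero q hq b
    simp only [Nat.bodd_succ, Bool.xor_not, Bool.not_not]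
    field_simp

/-- Inserting the largest value, with either sign, into one of the other blocks. -/
theorem sum_insertions_unflagged (hq : ∀ k, qn q k ≠ 0) {n b : ℕ} {st : List (Bool × ℕ)}
    (hn : b + (st.map Prod.snd).sum = n + 1)
    (ih : ∀ b st, b + (st.map Prod.snd).sum = n →
      ∑ x ∈ words n (flaggedShape b st), cellsWeight q (wordCells x) = wordSum q b st)
    {r : ℕ} (hr : r < st.length) :
    ∑ x ∈ insertions (words n) n (flaggedShape b st) (r + 1), cellsWeight q (wordCells x) =
      qfact q n / qfact q b * (st.map fun c => (blockDen q c.2)⁻¹).prod *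
        (endTerm q (true ^^ b.bodd) st r +
          startTerm q (fun e => -(if e then q else 1) * blockPass q e true b ^ 2)
            (true ^^ b.bodd) st r) := by
  obtain ⟨pre, ⟨s, l⟩, post, rfl, rfl⟩ : ∃ pre c post, st = pre ++ c :: post ∧ pre.length = r :=
    ⟨st.take r, st[r], st.drop (r + 1), by simp, by simp; omega⟩
  have hsh : ∀ c, flaggedShape b (pre ++ c :: post) =
      flaggedShape b pre ++ (false, c) :: post.map fun c => (false, c) := by
    simp [flaggedShape]
  have hlen : pre.length + 1 = (flaggedShape b pre).length := by simp [flaggedShape]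
  rw [hlen, hsh]
  simp only [endTerm, startTerm, List.drop_left, List.take_left]
  rcases l with _ | l
  · rw [insertions_of_length_eq_zero]
    simp [shrinkFactor]
  rw [sum_insertions]
  simp only [Bool.false_eq_true, if_false, Nat.add_sub_cancel]
  have h1 : ∀ x ∈ words n (flaggedShape b pre ++ (false, s, l) :: post.map fun c => (false, c)),
      cellsWeight q (wordCells (x.modify (flaggedShape b pre).length (insEnd (n + 1)))) =
        cellsWeight q (wordCells x) * pass q (s ^^ l.bodd) post := fun x hx => by
    rw [← shapePass_map]
    exact cellsWeight_modify_insEnd q (mem_words.1 hx).shape_eq (by omega)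
      (abs_lt_of_mem_words hx)
  have h2 : ∀ x ∈ words n (flaggedShape b pre ++ (false, !s, l) :: post.map fun c => (false, c)),
      cellsWeight q (wordCells (x.modify (flaggedShape b pre).length (insStart (n + 1)))) =
        cellsWeight q (wordCells x) * (-(if s then q else 1) *
          (blockPass q s true b * pass q s pre) ^ 2 *
            (blockPass q s (!s) l * pass q s post)) := fun x hx => by
    rw [cellsWeight_modify_insStart q (mem_words.1 hx).shape_eq (by omega)
      (abs_lt_of_mem_words hx), flaggedShape, shapePass_cons, shapePass_map, shapePass_map]
  simp only [List.map_append, List.map_cons, List.sum_append, List.sum_cons] at hn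
  have h3 : ∀ s, b + ((pre ++ (s, l) :: post).map Prod.snd).sum = n := fun s => by
    simp only [List.map_append, List.map_cons, List.sum_append, List.sum_cons]
    omega
  rw [sum_congr rfl h1, sum_congr rfl h2, ← sum_mul, ← sum_mul, ← hsh, ← hsh, ih _ _ (h3 _),
    ih _ _ (h3 _), wordSum, wordSum, h3, h3]
  simp only [List.map_append, List.map_cons, List.prod_append, List.prod_cons,
    inv_blockDen q hq l]
  ring

/-- The signed weight sum over all words of a given shape. -/
theorem sum_cellsWeight (hq : ∀ k, qn q k ≠ 0) (n b : ℕ) (st : List (Bool × ℕ))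
    (hn : b + (st.map Prod.snd).sum = n) :
    ∑ x ∈ words n (flaggedShape b st), cellsWeight q (wordCells x) = wordSum q b st := by
  induction n generalizing b st with
  | zero =>
    obtain ⟨rfl, h⟩ : b = 0 ∧ (st.map Prod.snd).sum = 0 := by omega
    have h0 : ∀ c ∈ st, c.2 = 0 := fun c hc => by
      have := List.le_sum_of_mem (List.mem_map_of_mem (f := Prod.snd) hc)
      omega
    rw [words, if_pos, sum_singleton]
    · have h1 : wordCells ((flaggedShape 0 st).map fun c => (c.1, c.2.1, [])) = [] := by
        simp only [wordCells, List.flatMap_eq_nil_iff, List.mem_map]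
        rintro _ ⟨c, -, rfl⟩
        rfl
      have h2 : (st.map fun c => (blockDen q c.2)⁻¹).prod = 1 := by
        refine List.prod_eq_one fun a ha => ?_
        obtain ⟨c, hc, rfl⟩ := List.mem_map.1 ha
        simp [blockDen, h0 c hc]
      have h3 : ∀ π, patternWeight q π st = 1 := by
        clear h h2 h1 hn
        intro π
        induction st with
        | nil => rfl
        | cons c st ih =>
          rw [patternWeight, h0 c (by simp)]
          simp [blockWeight, ih fun c hc => h0 c (by simp [hc])]
      rw [h1, wordSum, h, h2, h3]
      simp [cellsWeight, qfact]
    · intro c hc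
      simp only [flaggedShape, List.mem_cons, List.mem_map] at hc
      obtain rfl | ⟨c, hc, rfl⟩ := hc
      · rfl
      · exact h0 c hc
  | succ n ih =>
    have hlen : (flaggedShape b st).length = st.length + 1 := by simp [flaggedShape]
    -- The flagged block plays the role of the factor `u` in `sum_startTerm`, with `c = q ^ b`.
    have hu : (-(if (true ^^ b.bodd) then q else 1) * blockPass q (true ^^ b.bodd) true b ^ 2 =
        -(q ^ b * q)) ∧ -(if (!(true ^^ b.bodd)) then q else 1) *
          blockPass q (!(true ^^ b.bodd)) true b ^ 2 = -q ^ b := by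
      rcases Nat.even_or_odd' b with ⟨k, rfl | rfl⟩
      · simp [blockPass_even]
        constructor <;> ring
      · simp [blockPass_odd]
        constructor <;> ring
    rw [sum_words_succ, hlen, sum_range_succ', sum_insertions_flagged q hq hn ih,
      sum_congr rfl fun r hr => sum_insertions_unflagged q hq hn ih (mem_range.1 hr), ← mul_sum,
      sum_add_distrib, sum_endTerm, sum_startTerm q (q ^ b) _ _ hu.1 hu.2, wordSum, hn, qfact_succ,
      ← hn, pow_add]
    ring

end Evaluation

/-! ### Length, descents and the statistic `L` in terms of inversions -/

/-- A signed permutation as a function on all integers, the identity outside `[±n]₀`. -/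
def ev {n : ℕ} (w : B n) (j : ℤ) : ℤ :=
  if h : -(n : ℤ) ≤ j ∧ j ≤ n then (w.1 ⟨j, h⟩).1 else j

theorem ev_of_mem {n : ℕ} (w : B n) {j : ℤ} (h : -(n : ℤ) ≤ j ∧ j ≤ n) :
    ev w j = (w.1 ⟨j, h⟩).1 := dif_pos h

theorem ev_val {n : ℕ} (w : B n) (y : PM n) : ev w y.1 = (w.1 y).1 := dif_pos y.2

theorem ev_mem {n : ℕ} (w : B n) {j : ℤ} (h : -(n : ℤ) ≤ j ∧ j ≤ n) :
    -(n : ℤ) ≤ ev w j ∧ ev w j ≤ n := by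
  rw [ev_of_mem w h]
  exact (w.1 ⟨j, h⟩).2

theorem ev_neg {n : ℕ} (w : B n) (j : ℤ) : ev w (-j) = -ev w j := by
  by_cases h : -(n : ℤ) ≤ j ∧ j ≤ n
  · have h' : -(n : ℤ) ≤ -j ∧ -j ≤ n := by omega
    rw [ev_of_mem w h, ev_of_mem w h', ← neg_val, ← w.2]
    rfl
  · rw [ev, ev, dif_neg h, dif_neg (by omega)]

theorem ev_zero {n : ℕ} (w : B n) : ev w 0 = 0 := by
  have := ev_neg w 0
  rw [neg_zero] at this
  omega

theorem ev_one {n : ℕ} (j : ℤ) : ev (1 : B n) j = j := by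
  unfold ev
  split_ifs <;> rfl

theorem ev_mul {n : ℕ} (w u : B n) (j : ℤ) : ev (w * u) j = ev w (ev u j) := by
  by_cases h : -(n : ℤ) ≤ j ∧ j ≤ n
  · rw [ev_of_mem _ h, ev_of_mem u h, ev_val]
    rfl
  · have : ev u j = j := dif_neg h
    rw [this, ev, ev, dif_neg h, dif_neg h]

theorem ev_injective {n : ℕ} (w : B n) : Function.Injective (ev w) := by
  have h : ∀ j, ev w⁻¹ (ev w j) = j := fun j => by rw [← ev_mul, inv_mul_cancel, ev_one]
  exact Function.LeftInverse.injective h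

theorem eq_of_ev_eq {n : ℕ} {w u : B n} (h : ∀ j : ℤ, 0 < j → j ≤ n → ev w j = ev u j) :
    w = u := by
  refine Subtype.ext (Equiv.ext fun y => Subtype.ext ?_)
  rw [← ev_val, ← ev_val]
  have hy := y.2
  rcases lt_trichotomy y.1 0 with hy0 | hy0 | hy0
  · have := h (-y.1) (by omega) (by omega)
    rwa [ev_neg, ev_neg, neg_inj] at this
  · rw [hy0, ev_zero, ev_zero]
  · exact h _ hy0 (by omega)

/-- The generator `s_i`, for `i ≥ 0`, as a function on the integers. -/
def sFun (i j : ℤ) : ℤ :=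
  if i = 0 then if j = 1 then -1 else if j = -1 then 1 else j
  else if j = i then i + 1 else if j = i + 1 then i else
    if j = -i then -(i + 1) else if j = -(i + 1) then -i else j

theorem sFun_sFun {i : ℤ} (hi : 0 ≤ i) (j : ℤ) : sFun i (sFun i j) = j := by
  generalize h : sFun i j = k
  unfold sFun at h ⊢
  split_ifs at h ⊢ <;> omega

theorem sFun_self {i : ℤ} (hi : 0 < i) : sFun i i = i + 1 := by
  rw [sFun, if_neg hi.ne', if_pos rfl]

theorem sFun_succ {i : ℤ} (hi : 0 < i) : sFun i (i + 1) = i := by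
  rw [sFun, if_neg hi.ne', if_neg (by omega), if_pos rfl]

theorem sFun_neg {i : ℤ} (hi : 0 < i) : sFun i (-i) = -(i + 1) := by
  rw [sFun, if_neg hi.ne', if_neg (by omega), if_neg (by omega), if_pos rfl]

theorem ev_s {n : ℕ} (i : Fin n) (j : ℤ) : ev (s n i) j = sFun i j := by
  have hi := i.2
  by_cases h : -(n : ℤ) ≤ j ∧ j ≤ n
  · rw [ev_of_mem _ h]
    simp only [s, genPerm, sFun]
    by_cases h0 : (i : ℕ) = 0
    · rw [if_pos h0, if_pos (by omega), Equiv.swap_apply_def]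
      simp only [Subtype.ext_iff, neg_val, pt_val]
      split_ifs <;> simp only [neg_val, pt_val] <;> omega
    · rw [if_neg h0, if_neg (by omega), Equiv.Perm.mul_apply]
      simp only [Equiv.swap_apply_def]
      split_ifs <;> simp only [Subtype.ext_iff, neg_val, pt_val] at * <;> omega
  · rw [ev, dif_neg h]
    unfold sFun
    split_ifs <;> omega

theorem s_mul_self {n : ℕ} (i : Fin n) : s n i * s n i = 1 := by
  refine eq_of_ev_eq fun j _ _ => ?_
  rw [ev_mul, ev_s, ev_s, ev_one, sFun_sFun (by omega)]

/-- The pairs `(i, j)` with `|i| < j ≤ n`. They represent the orbits of `(i, j) ↦ (-j, -i)` on the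
pairs `i < j` with `i ≠ -j`, and they correspond to the positive roots, where the pairs `(0, j)`
play the role of the pairs `(-j, j)`. -/
noncomputable def pairs (n : ℕ) : Finset (ℤ × ℤ) :=
  {p ∈ Icc (-(n : ℤ)) n ×ˢ Icc (1 : ℤ) n | |p.1| < p.2}

theorem mem_pairs {n : ℕ} {p : ℤ × ℤ} : p ∈ pairs n ↔ -p.2 < p.1 ∧ p.1 < p.2 ∧ p.2 ≤ n := by
  simp only [pairs, mem_filter, mem_product, mem_Icc, abs_lt]
  omega

/-- The inversions of a signed permutation, as pairs of positions. -/
noncomputable def inversions {n : ℕ} (w : B n) : Finset (ℤ × ℤ) :=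
  {p ∈ pairs n | ev w p.2 < ev w p.1}

theorem mem_inversions {n : ℕ} {w : B n} {p : ℤ × ℤ} :
    p ∈ inversions w ↔ (-p.2 < p.1 ∧ p.1 < p.2 ∧ p.2 ≤ n) ∧ ev w p.2 < ev w p.1 := by
  rw [inversions, mem_filter, mem_pairs]

/-- The permutation of the positive roots other than the simple root `(i, i + 1)` that `s_i`
induces. Applying `s_i` to the pair `(-i, i + 1)` gives `(-(i + 1), i)`, which represents the same
root, so this pair is fixed. -/
def rootFun (i : ℤ) (p : ℤ × ℤ) : ℤ × ℤ :=
  if p = (-i, i + 1) then p else (sFun i p.1, sFun i p.2)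

theorem rootFun_spec {n : ℕ} {i : ℤ} (hi : 0 ≤ i) (hin : i < n) {p : ℤ × ℤ}
    (hp : -p.2 < p.1 ∧ p.1 < p.2 ∧ p.2 ≤ n) (hne : p ≠ (i, i + 1)) :
    (-(rootFun i p).2 < (rootFun i p).1 ∧ (rootFun i p).1 < (rootFun i p).2 ∧
      (rootFun i p).2 ≤ n) ∧ rootFun i p ≠ (i, i + 1) ∧ rootFun i (rootFun i p) = p := by
  obtain ⟨a, b⟩ := p
  by_cases h : (a, b) = (-i, i + 1)
  · have : rootFun i (a, b) = (a, b) := if_pos h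
    rw [this, this]
    exact ⟨hp, hne, rfl⟩
  · have h1 : rootFun i (a, b) = (sFun i a, sFun i b) := if_neg h
    simp only [ne_eq, Prod.mk.injEq, not_and] at h hne hp
    have h2 : ¬(sFun i a = -i ∧ sFun i b = i + 1) := by
      rintro ⟨ha, hb⟩
      have ha' := congrArg (sFun i) ha
      have hb' := congrArg (sFun i) hb
      rw [sFun_sFun hi] at ha' hb'
      simp only [sFun] at ha' hb'
      split_ifs at ha' hb' <;> omega
    have h3 : ¬(sFun i a = i ∧ sFun i b = i + 1) := by
      rintro ⟨ha, hb⟩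
      have ha' := congrArg (sFun i) ha
      have hb' := congrArg (sFun i) hb
      rw [sFun_sFun hi] at ha' hb'
      simp only [sFun] at ha' hb'
      split_ifs at ha' hb' <;> omega
    rw [h1]
    refine ⟨?_, by simpa using h3, ?_⟩
    · simp only [sFun]
      split_ifs <;> omega
    · rw [rootFun, if_neg (by simpa using h2)]
      simp only [sFun_sFun hi]

/-- Right multiplication by `s_i` at an ascent creates exactly one inversion. -/
theorem card_inversions_mul_s {n : ℕ} (w : B n) (i : Fin n)
    (h : ev w (i : ℕ) < ev w ((i : ℕ) + 1)) :
    #(inversions (w * s n i)) = #(inversions w) + 1 := by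
  have hi := i.2
  have hs : ∀ j, ev (w * s n i) j = ev w (sFun (i : ℕ) j) := fun j => by rw [ev_mul, ev_s]
  have hmem : (((i : ℕ) : ℤ), ((i : ℕ) : ℤ) + 1) ∈ inversions (w * s n i) := by
    rw [mem_inversions, hs, hs]
    refine ⟨by simp only; omega, ?_⟩
    by_cases h0 : ((i : ℕ) : ℤ) = 0
    · rw [h0] at h ⊢
      simp only [sFun]
      norm_num [ev_neg, ev_zero] at h ⊢
      exact h
    · have hpos : (0 : ℤ) < (i : ℕ) := by omega
      simp only [sFun_self hpos, sFun_succ hpos, h]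
  have hval : ∀ p : ℤ × ℤ, p ≠ (((i : ℕ) : ℤ), ((i : ℕ) : ℤ) + 1) →
      (ev (w * s n i) (rootFun (i : ℕ) p).2 < ev (w * s n i) (rootFun (i : ℕ) p).1 ↔
        ev w p.2 < ev w p.1) := by
    rintro ⟨a, b⟩ hp
    by_cases hab : (a, b) = (-((i : ℕ) : ℤ), ((i : ℕ) : ℤ) + 1)
    · have : rootFun (i : ℕ) (a, b) = (a, b) := if_pos hab
      rw [this, hs, hs]
      simp only [Prod.mk.injEq] at hab
      obtain ⟨rfl, rfl⟩ := hab
      have h0 : ((i : ℕ) : ℤ) ≠ 0 := by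
        rintro h0
        rw [h0] at hp
        simp at hp
      have hpos : (0 : ℤ) < (i : ℕ) := by omega
      simp only [sFun_neg hpos, sFun_succ hpos, ev_neg]
      omega
    · have : rootFun (i : ℕ) (a, b) = (sFun (i : ℕ) a, sFun (i : ℕ) b) := if_neg hab
      rw [this, hs, hs]
      simp only [sFun_sFun (show (0 : ℤ) ≤ (i : ℕ) by omega)]
  rw [← card_erase_add_one hmem]
  congr 1
  symm
  have hroot := fun p hp hne => rootFun_spec (n := n) (i := (i : ℕ)) (by omega) (by omega)
    (p := p) hp hne
  refine card_nbij' (rootFun (i : ℕ)) (rootFun (i : ℕ)) ?_ ?_ ?_ ?_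
  · intro p hp
    rw [mem_coe, mem_inversions] at hp
    have hne : p ≠ (((i : ℕ) : ℤ), ((i : ℕ) : ℤ) + 1) := by
      rintro rfl
      exact absurd hp.2 (by simp only; omega)
    obtain ⟨h1, h2, -⟩ := hroot p hp.1 hne
    rw [mem_coe, mem_erase, mem_inversions, hval p hne]
    exact ⟨h2, h1, hp.2⟩
  · intro p hp
    rw [mem_coe, mem_erase, mem_inversions] at hp
    obtain ⟨hne, hp, hlt⟩ := hp
    obtain ⟨h1, h2, h3⟩ := hroot p hp hne
    rw [mem_coe, mem_inversions]
    refine ⟨h1, ?_⟩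
    rw [← hval _ h2, h3]
    exact hlt
  · intro p hp
    rw [mem_coe, mem_inversions] at hp
    refine (hroot p hp.1 ?_).2.2
    rintro rfl
    exact absurd hp.2 (by simp only; omega)
  · intro p hp
    rw [mem_coe, mem_erase, mem_inversions] at hp
    exact (hroot p hp.2.1 hp.1).2.2

theorem card_inversions_mul_s_of_descent {n : ℕ} (w : B n) (i : Fin n)
    (h : ev w ((i : ℕ) + 1) < ev w (i : ℕ)) :
    #(inversions (w * s n i)) + 1 = #(inversions w) := by
  have h1 := card_inversions_mul_s (w * s n i) i
  rw [mul_assoc, s_mul_self, mul_one] at h1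
  refine (h1 ?_).symm
  rw [ev_mul, ev_mul, ev_s, ev_s]
  by_cases h0 : ((i : ℕ) : ℤ) = 0
  · rw [h0] at h ⊢
    simp only [sFun]
    norm_num [ev_neg, ev_zero] at h ⊢
    exact h
  · have hpos : (0 : ℤ) < (i : ℕ) := by omega
    rwa [sFun_self hpos, sFun_succ hpos]

theorem ev_lt_or_lt {n : ℕ} (w : B n) (i : ℤ) : ev w i < ev w (i + 1) ∨ ev w (i + 1) < ev w i := by
  refine lt_or_gt_of_ne fun h => ?_
  have := ev_injective w h
  omega

theorem eq_one_of_forall_ascent {n : ℕ} (w : B n)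
    (h : ∀ i : Fin n, ev w (i : ℕ) < ev w ((i : ℕ) + 1)) : w = 1 := by
  have h1 : ∀ j : ℕ, j ≤ n → (j : ℤ) ≤ ev w j := by
    intro j
    induction j with
    | zero => simp [ev_zero]
    | succ j ih =>
      intro hj
      have := h ⟨j, by omega⟩
      have := ih (by omega)
      push_cast
      simp only at *
      omega
  have h2 : ∀ k j : ℕ, j + k = n → ev w j ≤ j := by
    intro k
    induction k with
    | zero =>
      rintro j rfl
      exact (ev_mem w ⟨by omega, by omega⟩).2
    | succ k ih =>
      intro j hj
      have h3 := h ⟨j, by omega⟩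
      have h4 := ih (j + 1) (by omega)
      push_cast at h4
      simp only at *
      omega
  refine eq_of_ev_eq fun j hj hjn => ?_
  obtain ⟨k, rfl⟩ := Int.eq_ofNat_of_zero_le hj.le
  have := h1 k (by omega)
  have := h2 (n - k) k (by omega)
  rw [ev_one]
  omega

theorem exists_word {n : ℕ} (w : B n) :
    ∃ ω : List (Fin n), ω.length = #(inversions w) ∧ (ω.map (s n)).prod = w := by
  induction hk : #(inversions w) generalizing w with
  | zero =>
    refine ⟨[], rfl, ?_⟩
    rw [List.map_nil, List.prod_nil, eq_one_of_forall_ascent w fun i => ?_]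
    refine (ev_lt_or_lt w _).resolve_right fun h => ?_
    have := card_inversions_mul_s_of_descent w i h
    omega
  | succ k ih =>
    obtain ⟨i, hi⟩ : ∃ i : Fin n, ev w ((i : ℕ) + 1) < ev w (i : ℕ) := by
      by_contra! h
      have : w = 1 := eq_one_of_forall_ascent w fun i =>
        (ev_lt_or_lt w _).resolve_right (not_lt.2 (h i))
      subst this
      have : inversions (1 : B n) = ∅ := by
        refine eq_empty_of_forall_notMem fun p hp => ?_
        rw [mem_inversions, ev_one, ev_one] at hp
        omega
      rw [this, card_empty] at hk
      omega
    have := card_inversions_mul_s_of_descent w i hi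
    obtain ⟨ω, h1, h2⟩ := ih (w * s n i) (by omega)
    exact ⟨ω ++ [i], by simp [h1], by simp [h2, mul_assoc, s_mul_self]⟩

theorem card_inversions_prod_le {n : ℕ} (ω : List (Fin n)) :
    #(inversions (ω.map (s n)).prod) ≤ ω.length := by
  induction ω using List.reverseRecOn with
  | nil =>
    refine (card_eq_zero.2 (eq_empty_of_forall_notMem fun p hp => ?_)).le
    rw [List.map_nil, List.prod_nil, mem_inversions, ev_one, ev_one] at hp
    omega
  | append_singleton ω i ih =>
    simp only [List.map_append, List.map_cons, List.map_nil, List.prod_append, List.prod_singleton,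
      List.length_append, List.length_singleton]
    rcases ev_lt_or_lt (ω.map (s n)).prod (i : ℕ) with h | h
    · rw [card_inversions_mul_s _ i h]
      omega
    · have := card_inversions_mul_s_of_descent _ i h
      omega

/-- The Coxeter length is the number of inversions. -/
theorem len_eq_card_inversions {n : ℕ} (w : B n) : len w = #(inversions w) := by
  refine le_antisymm (Nat.sInf_le (exists_word w)) (le_csInf ⟨_, exists_word w⟩ ?_)
  rintro k ⟨ω, rfl, rfl⟩
  exact card_inversions_prod_le ω

theorem mem_D {n : ℕ} {w : B n} {i : ℕ} : i ∈ D w ↔ i < n ∧ ev w ((i : ℤ) + 1) < ev w i := by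
  have key : ∀ i : Fin n, len (w * s n i) < len w ↔ ev w ((i : ℕ) + 1) < ev w (i : ℕ) := by
    intro i
    rw [len_eq_card_inversions, len_eq_card_inversions]
    rcases ev_lt_or_lt w (i : ℕ) with h | h
    · rw [card_inversions_mul_s _ i h]
      omega
    · have := card_inversions_mul_s_of_descent _ i h
      omega
  simp only [D, mem_map, mem_filter, mem_univ, true_and, key, Fin.valEmbedding_apply]
  constructor
  · rintro ⟨i, h, rfl⟩
    exact ⟨i.2, h⟩
  · rintro ⟨hi, h⟩
    exact ⟨⟨i, hi⟩, h, rfl⟩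

/-- The factor one half in the definition of `L` is accounted for by counting only one pair of
each orbit of `(i, j) ↦ (-j, -i)`. -/
theorem L_eq_card {n : ℕ} (w : B n) : L w = #{p ∈ inversions w | ¬p.1 ≡ p.2 [ZMOD 2]} := by
  have h2 := two_mul_L w
  set S : Finset (PM n × PM n) :=
    {p | p.1.1 < p.2.1 ∧ (w.1 p.2).1 < (w.1 p.1).1 ∧ ¬ p.1.1 ≡ p.2.1 [ZMOD 2]} with hS
  have hmem : ∀ p : PM n × PM n, p ∈ S ↔
      p.1.1 < p.2.1 ∧ (w.1 p.2).1 < (w.1 p.1).1 ∧ ¬ p.1.1 ≡ p.2.1 [ZMOD 2] := by simp [hS]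
  have hsplit := card_filter_add_card_filter_not (s := S) fun p : PM n × PM n => -p.2.1 < p.1.1
  have e1 : #{p ∈ S | -p.2.1 < p.1.1} = #{p ∈ inversions w | ¬p.1 ≡ p.2 [ZMOD 2]} := by
    refine card_bij (fun p _ => (p.1.1, p.2.1)) ?_ ?_ ?_
    · rintro ⟨a, b⟩ hp
      rw [mem_filter, hmem] at hp
      rw [mem_filter, mem_inversions, ev_val, ev_val]
      have := b.2
      exact ⟨⟨⟨hp.2, hp.1.1, by simp only; omega⟩, hp.1.2.1⟩, hp.1.2.2⟩
    · rintro ⟨a, b⟩ _ ⟨a', b'⟩ _ h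
      simp only [Prod.mk.injEq] at h
      exact Prod.ext (Subtype.ext h.1) (Subtype.ext h.2)
    · rintro ⟨a, b⟩ hp
      rw [mem_filter, mem_inversions] at hp
      simp only at hp
      refine ⟨(⟨a, by omega⟩, ⟨b, by omega⟩), ?_, rfl⟩
      rw [mem_filter, hmem, ← ev_val, ← ev_val]
      exact ⟨⟨hp.1.1.2.1, hp.1.2, hp.2⟩, hp.1.1.1⟩
  have e2 : #{p ∈ S | ¬-p.2.1 < p.1.1} = #{p ∈ S | -p.2.1 < p.1.1} := by
    refine card_nbij' (fun p => (-p.2, -p.1)) (fun p => (-p.2, -p.1)) ?_ ?_ ?_ ?_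
    · rintro ⟨a, b⟩ hp
      rw [mem_coe, mem_filter, hmem] at hp ⊢
      rw [w.2, w.2]
      simp only [neg_val, Int.modEq_iff_dvd] at hp ⊢
      omega
    · rintro ⟨a, b⟩ hp
      rw [mem_coe, mem_filter, hmem] at hp ⊢
      rw [w.2, w.2]
      simp only [neg_val, Int.modEq_iff_dvd] at hp ⊢
      omega
    · rintro ⟨a, b⟩ _
      simp
    · rintro ⟨a, b⟩ _
      simp
  omega

section Weight

variable {R : Type*} [CommRing R] (q : R)

/-- The contribution of a pair of positions to `(-1) ^ l(w) * q ^ L(w)`. -/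
def rootFactor {n : ℕ} (w : B n) (p : ℤ × ℤ) : R :=
  if ev w p.2 < ev w p.1 then -(if p.1 ≡ p.2 [ZMOD 2] then 1 else q) else 1

theorem prod_rootFactor {n : ℕ} (w : B n) :
    ∏ p ∈ pairs n, rootFactor q w p = (-1) ^ len w * q ^ L w := by
  simp only [rootFactor]
  rw [← prod_filter, ← inversions, prod_neg, len_eq_card_inversions, L_eq_card, prod_ite,
    prod_const_one, one_mul, prod_const]

theorem prod_pairs {M : Type*} [CommMonoid M] (n : ℕ) (φ : ℤ × ℤ → M) :
    ∏ p ∈ pairs n, φ p = ∏ k ∈ range n, ∏ i ∈ Ioo (-((k : ℤ) + 1)) (k + 1), φ (i, k + 1) := by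
  rw [prod_sigma']
  refine prod_bij' (fun p _ => ⟨(p.2 - 1).toNat, p.1⟩) (fun x _ => (x.2, x.1 + 1)) ?_ ?_ ?_ ?_ ?_
  · rintro ⟨a, b⟩ hp
    rw [mem_pairs] at hp
    simp only [mem_sigma, mem_range, mem_Ioo] at hp ⊢
    omega
  · rintro ⟨k, i⟩ hx
    simp only [mem_sigma, mem_range, mem_Ioo] at hx
    rw [mem_pairs]
    simp only
    omega
  · rintro ⟨a, b⟩ hp
    rw [mem_pairs] at hp
    simp only [Prod.mk.injEq, true_and] at hp ⊢
    omega
  · rintro ⟨k, i⟩ hx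
    simp
  · rintro ⟨a, b⟩ hp
    rw [mem_pairs] at hp
    simp only at hp ⊢
    congr
    omega

theorem prod_Ioo_neg {M : Type*} [CommMonoid M] (k : ℕ) (φ : ℤ → M) :
    ∏ i ∈ Ioo (-((k : ℤ) + 1)) (k + 1), φ i =
      φ 0 * ∏ a ∈ range k, (φ (a + 1) * φ (-(a + 1))) := by
  induction k with
  | zero =>
    have : Ioo (-(((0 : ℕ) : ℤ) + 1)) ((0 : ℕ) + 1) = {0} := by
      ext i
      simp only [mem_Ioo, mem_singleton]
      omega
    rw [this]
    simp
  | succ k ih =>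
    have : Ioo (-(((k + 1 : ℕ) : ℤ) + 1)) ((k + 1 : ℕ) + 1) =
        insert ((k : ℤ) + 1) (insert (-((k : ℤ) + 1)) (Ioo (-((k : ℤ) + 1)) (k + 1))) := by
      ext i
      simp only [mem_Ioo, mem_insert]
      push_cast
      omega
    rw [this, prod_insert, prod_insert, ih, prod_range_succ]
    · rw [mul_comm (φ (-((k : ℤ) + 1))), mul_left_comm, mul_assoc]
    · simp only [mem_Ioo]
      omega
    · simp only [mem_insert, mem_Ioo]
      omega

theorem cellsWeight_append_singleton (l : List (Bool × ℤ)) (c : Bool × ℤ) :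
    cellsWeight q (l ++ [c]) =
      cellsWeight q l * (cellFactor q c * (l.map fun a => pairFactor q a c).prod) := by
  induction l with
  | nil => simp [cellsWeight]
  | cons a l ih =>
    simp only [List.cons_append, cellsWeight, ih, List.map_append, List.map_cons, List.map_nil,
      List.prod_append, List.prod_cons, List.prod_nil]
    ring

theorem cellsWeight_map_range (n : ℕ) (c : ℕ → Bool × ℤ) :
    cellsWeight q ((List.range n).map c) =
      ∏ k ∈ range n, (cellFactor q (c k) * ∏ a ∈ range k, pairFactor q (c a) (c k)) := by
  induction n with
  | zero => simp [cellsWeight]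
  | succ n ih =>
    rw [List.range_succ, List.map_append, List.map_singleton, cellsWeight_append_singleton, ih,
      prod_range_succ]
    congr 2
    rw [List.map_map]
    rfl

end Weight

/-! ### Quotients of the hyperoctahedral group as sets of words -/

/-- The values `w(a + 1), …, w(b)` of a signed permutation. -/
def segment {n : ℕ} (w : B n) (a b : ℕ) : List ℤ :=
  (List.range' a (b - a)).map fun k : ℕ => ev w (k + 1)

theorem length_segment {n : ℕ} (w : B n) (a b : ℕ) : (segment w a b).length = b - a := by
  simp [segment]

theorem segment_append {n : ℕ} (w : B n) {a b c : ℕ} (hab : a ≤ b) (hbc : b ≤ c) :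
    segment w a b ++ segment w b c = segment w a c := by
  obtain ⟨d, rfl⟩ := Nat.exists_eq_add_of_le hab
  obtain ⟨e, rfl⟩ := Nat.exists_eq_add_of_le hbc
  have h1 : a + d - a = d := by omega
  have h2 : a + d + e - (a + d) = e := by omega
  have h3 : a + d + e - a = d + e := by omega
  rw [segment, segment, segment, ← List.map_append, h1, h2, h3, List.range'_append_1]

theorem mem_segment {n : ℕ} {w : B n} {a b : ℕ} {v : ℤ} :
    v ∈ segment w a b ↔ ∃ k : ℕ, a ≤ k ∧ k < b ∧ ev w (k + 1) = v := by
  simp only [segment, List.mem_map, List.mem_range'_1]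
  constructor
  · rintro ⟨k, hk, rfl⟩
    exact ⟨k, hk.1, by omega, rfl⟩
  · rintro ⟨k, h1, h2, rfl⟩
    exact ⟨k, by omega, rfl⟩

theorem blockCells_map_range (n : ℕ) (v : ℕ → ℤ) :
    blockCells true ((List.range n).map v) = (List.range n).map fun k => (!k.bodd, v k) := by
  induction n with
  | zero => rfl
  | succ n ih =>
    rw [List.range_succ, List.map_append, List.map_append, blockCells_append, ih]
    simp [blockCells]

theorem modEq_two_iff (a b : ℕ) : (a : ℤ) ≡ b [ZMOD 2] ↔ a.bodd = b.bodd := by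
  rw [show (2 : ℤ) = ((2 : ℕ) : ℤ) from rfl, Int.natCast_modEq_iff, Nat.ModEq,
    Nat.mod_two_of_bodd, Nat.mod_two_of_bodd]
  cases a.bodd <;> cases b.bodd <;> simp

/-- The signed weight of the window of `w` is `(-1) ^ l(w) * q ^ L(w)`. -/
theorem cellsWeight_segment {R : Type*} [CommRing R] (q : R) {n : ℕ} (w : B n) :
    cellsWeight q (blockCells true (segment w 0 n)) = (-1) ^ len w * q ^ L w := by
  rw [segment, Nat.sub_zero, ← List.range_eq_range', blockCells_map_range, cellsWeight_map_range,
    ← prod_rootFactor, prod_pairs]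
  refine prod_congr rfl fun k _ => ?_
  rw [prod_Ioo_neg]
  have hpar : ∀ a : ℕ, ((a : ℤ) + 1 ≡ (k : ℤ) + 1 [ZMOD 2]) ↔ (!k.bodd) = !a.bodd := fun a => by
    have := modEq_two_iff (a + 1) (k + 1)
    push_cast at this
    rw [this, Nat.bodd_succ, Nat.bodd_succ, eq_comm]
  congr 1
  · have h0 : (0 : ℤ) ≡ (k : ℤ) + 1 [ZMOD 2] ↔ ¬(!k.bodd) = true := by
      have := modEq_two_iff 0 (k + 1)
      push_cast at this
      rw [this, Nat.bodd_succ, Nat.bodd_zero, eq_comm, Bool.not_eq_true]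
    simp only [cellFactor, rootFactor, ev_zero, h0]
    split_ifs <;> simp_all
  · refine prod_congr rfl fun a _ => ?_
    have hneg : (-((a : ℤ) + 1) ≡ (k : ℤ) + 1 [ZMOD 2]) ↔ ((a : ℤ) + 1 ≡ (k : ℤ) + 1 [ZMOD 2]) := by
      simp only [Int.modEq_iff_dvd]
      omega
    have hlt : ev w (k + 1) < -ev w (a + 1) ↔ ev w (a + 1) + ev w (k + 1) < 0 := by omega
    simp only [pairFactor, rootFactor, ev_neg, hneg, hpar, hlt]

theorem segment_natAbs_perm {n : ℕ} (w : B n) :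
    ((segment w 0 n).map Int.natAbs).Perm (List.range' 1 n) := by
  have hnd : ((segment w 0 n).map Int.natAbs).Nodup := by
    rw [segment, List.map_map]
    refine List.Nodup.map_on ?_ (List.nodup_range' ..)
    intro a _ b _ h
    rcases Int.natAbs_eq_natAbs_iff.1 h with h | h
    · have := ev_injective w h
      omega
    · rw [← ev_neg] at h
      have := ev_injective w h
      omega
  refine (List.subperm_of_subset hnd ?_).perm_of_length_le ?_
  · intro v hv
    obtain ⟨u, hu, rfl⟩ := List.mem_map.1 hv
    obtain ⟨k, -, hk, rfl⟩ := mem_segment.1 hu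
    have h1 := ev_mem w (j := k + 1) (by omega)
    have h2 : ev w (k + 1) ≠ ev w 0 := fun h => by
      have := ev_injective w h
      omega
    rw [ev_zero] at h2
    rw [List.mem_range'_1]
    omega
  · simp [length_segment]

/-- Every sequence of integers whose absolute values are `1, …, n` in some order is the window of
a signed permutation. -/
theorem exists_segment_eq {n : ℕ} {v : List ℤ} (hv : (v.map Int.natAbs).Perm (List.range' 1 n)) :
    ∃ w : B n, segment w 0 n = v := by
  have hlen : v.length = n := by simpa using hv.length_eq
  have hmem : ∀ a ∈ v, 1 ≤ a.natAbs ∧ a.natAbs ≤ n := fun a ha => by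
    have := hv.mem_iff.1 (List.mem_map_of_mem ha)
    rw [List.mem_range'_1] at this
    omega
  have hnd : (v.map Int.natAbs).Nodup := hv.nodup_iff.2 (List.nodup_range' ..)
  have hinj : ∀ a b : ℕ, ∀ (ha : a < v.length) (hb : b < v.length),
      (v[a]).natAbs = (v[b]).natAbs → a = b := by
    intro a b ha hb h
    refine (hnd.getElem_inj_iff (i := a) (j := b) (hi := by simpa) (hj := by simpa)).1 ?_
    simpa using h
  set g : ℤ → ℤ := fun j => if 0 < j then v.getD (j.natAbs - 1) 0 else
    if j < 0 then -v.getD (j.natAbs - 1) 0 else 0 with hg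
  have hget : ∀ a (ha : a < v.length), v.getD a 0 = v[a] := fun a ha => by
    simp [List.getD_eq_getElem?_getD, ha]
  have hgpos : ∀ j : ℤ, 0 < j → j ≤ n → g j = v.getD (j.natAbs - 1) 0 := fun j h _ => if_pos h
  have hgneg : ∀ j, g (-j) = -g j := by
    intro j
    simp only [hg, Int.natAbs_neg]
    rcases lt_trichotomy j 0 with h | rfl | h
    · rw [if_pos (by omega), if_neg (by omega), if_pos h, neg_neg]
    · simp
    · rw [if_neg (by omega), if_pos (by omega), if_pos h]
  have hgabs : ∀ j : ℤ, j ≠ 0 → (g j).natAbs = (v.getD (j.natAbs - 1) 0).natAbs := by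
    intro j hj
    simp only [hg]
    split_ifs
    · rfl
    · rw [Int.natAbs_neg]
    · omega
  have hbd : ∀ j : ℤ, -(n : ℤ) ≤ j ∧ j ≤ n → j ≠ 0 → 1 ≤ (g j).natAbs ∧ (g j).natAbs ≤ n := by
    intro j hj h0
    rw [hgabs j h0, hget _ (by omega)]
    exact hmem _ (List.getElem_mem _)
  have hg0 : g 0 = 0 := by simp [hg]
  have hgmem : ∀ j : ℤ, -(n : ℤ) ≤ j ∧ j ≤ n → -(n : ℤ) ≤ g j ∧ g j ≤ n := by
    intro j hj
    by_cases h0 : j = 0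
    · rw [h0, hg0]
      omega
    · have := hbd j hj h0
      omega
  have hginj : ∀ i j : ℤ, -(n : ℤ) ≤ i ∧ i ≤ n → -(n : ℤ) ≤ j ∧ j ≤ n → g i = g j → i = j := by
    intro i j hi hj h
    by_cases hi0 : i = 0
    · by_contra hij
      have := hbd j hj (by omega)
      rw [hi0, hg0] at h
      omega
    by_cases hj0 : j = 0
    · have := hbd i hi hi0
      rw [hj0, hg0] at h
      omega
    have h1 := congrArg Int.natAbs h
    rw [hgabs i hi0, hgabs j hj0, hget _ (by omega), hget _ (by omega)] at h1
    have h2 := hinj _ _ _ _ h1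
    have h3 : i = j ∨ i = -j := by omega
    rcases h3 with h3 | rfl
    · exact h3
    · rw [hgneg] at h
      have := hbd j hj hj0
      omega
  let φ : PM n → PM n := fun y => ⟨g y.1, hgmem y.1 y.2⟩
  have hφ : Function.Bijective φ := by
    rw [← Finite.injective_iff_bijective]
    intro y z h
    exact Subtype.ext (hginj _ _ y.2 z.2 (congrArg Subtype.val h))
  refine ⟨⟨Equiv.ofBijective φ hφ, fun j => Subtype.ext (hgneg j.1)⟩, ?_⟩
  refine List.ext_getElem (by rw [length_segment, hlen, Nat.sub_zero]) fun k h1 h2 => ?_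
  have hk : -(n : ℤ) ≤ (k : ℤ) + 1 ∧ (k : ℤ) + 1 ≤ n := by omega
  simp only [segment, List.getElem_map, List.getElem_range', zero_add, one_mul]
  rw [ev_of_mem _ hk]
  change g ((k : ℤ) + 1) = _
  rw [hgpos _ (by omega) hk.2, ← hget k h2]
  congr 1

theorem idx_of_le {n : ℕ} {I : Finset ℕ} {r : ℕ} (h : #I ≤ r) : idx n I r = n :=
  dif_neg (by omega)

theorem idx_mem {n : ℕ} {I : Finset ℕ} {r : ℕ} (h : r < #I) : idx n I r ∈ I := by
  rw [idx, dif_pos h]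
  exact I.orderEmbOfFin_mem rfl _

theorem idx_lt_idx_succ {n : ℕ} {I : Finset ℕ} (hI : I ⊆ range n) {r : ℕ} (h : r < #I) :
    idx n I r < idx n I (r + 1) := by
  by_cases h' : r + 1 < #I
  · rw [idx, idx, dif_pos h, dif_pos h']
    exact (I.orderEmbOfFin rfl).strictMono (by simp)
  · rw [idx_of_le (r := r + 1) (by omega)]
    exact mem_range.1 (hI (idx_mem h))

theorem idx_le_idx_succ {n : ℕ} {I : Finset ℕ} (hI : I ⊆ range n) (r : ℕ) :
    idx n I r ≤ idx n I (r + 1) := by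
  by_cases h : r < #I
  · exact (idx_lt_idx_succ hI h).le
  · rw [idx_of_le (r := r) (by omega), idx_of_le (r := r + 1) (by omega)]

theorem idx_monotone {n : ℕ} {I : Finset ℕ} (hI : I ⊆ range n) : Monotone (idx n I) :=
  monotone_nat_of_le_succ (idx_le_idx_succ hI)

theorem exists_idx_eq (n : ℕ) {I : Finset ℕ} {i : ℕ} (hi : i ∈ I) : ∃ r < #I, idx n I r = i := by
  have : i ∈ Set.range (I.orderEmbOfFin rfl) := by rwa [range_orderEmbOfFin]
  obtain ⟨r, rfl⟩ := this
  exact ⟨r, r.2, dif_pos r.2⟩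

theorem notMem_of_lt_idx_zero {n : ℕ} {I : Finset ℕ} (hI : I ⊆ range n) {i : ℕ}
    (h : i < idx n I 0) : i ∉ I := by
  intro hi
  obtain ⟨r, -, rfl⟩ := exists_idx_eq n hi
  exact absurd (idx_monotone hI (Nat.zero_le r)) (by omega)

theorem notMem_of_idx_lt_of_lt_idx {n : ℕ} {I : Finset ℕ} (hI : I ⊆ range n) {r i : ℕ}
    (h₁ : idx n I r < i) (h₂ : i < idx n I (r + 1)) : i ∉ I := by
  intro hi
  obtain ⟨t, -, rfl⟩ := exists_idx_eq n hi
  rcases Nat.lt_or_ge r t with h | h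
  · exact absurd (idx_monotone hI (show r + 1 ≤ t from h)) (by omega)
  · exact absurd (idx_monotone hI h) (by omega)

theorem exists_between_idx {n : ℕ} {I : Finset ℕ} {i : ℕ} (hi : i < n)
    (hiI : i ∉ I) : i < idx n I 0 ∨ ∃ r < #I, idx n I r < i ∧ i < idx n I (r + 1) := by
  by_contra! h
  have key : ∀ r ≤ #I, idx n I r ≤ i := by
    intro r
    induction r with
    | zero => exact fun _ => h.1
    | succ r ih =>
      intro hr
      refine h.2 r hr (lt_of_le_of_ne (ih (by omega)) fun he => hiI ?_)
      rw [← he]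
      exact idx_mem hr
  have := key #I le_rfl
  rw [idx_of_le le_rfl] at this
  omega

/-- The pattern of unflagged blocks that belongs to `I`: the block `r` occupies the positions
`i_{r+1} + 1, …, i_{r+2}`. -/
def pattern (n : ℕ) (I : Finset ℕ) : List (Bool × ℕ) :=
  (List.range #I).map fun r => (true ^^ (idx n I r).bodd, idx n I (r + 1) - idx n I r)

/-- The window of `w`, cut into blocks after the positions in `I`. -/
def toWord {n : ℕ} (I : Finset ℕ) (w : B n) : List Block :=
  (true, true, segment w 0 (idx n I 0)) :: (List.range #I).map fun r =>
    (false, true ^^ (idx n I r).bodd, segment w (idx n I r) (idx n I (r + 1)))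

theorem shape_toWord {n : ℕ} (I : Finset ℕ) (w : B n) :
    shape (toWord I w) = flaggedShape (idx n I 0) (pattern n I) := by
  simp [shape, toWord, flaggedShape, pattern, length_segment]

theorem flatMap_toWord {n : ℕ} {I : Finset ℕ} (hI : I ⊆ range n) (w : B n) :
    ((toWord I w).flatMap fun b => b.2.2) = segment w 0 n := by
  have key : ∀ m, segment w 0 (idx n I 0) ++ ((List.range m).flatMap fun r =>
      segment w (idx n I r) (idx n I (r + 1))) = segment w 0 (idx n I m) := by
    intro m
    induction m with
    | zero => simp
    | succ m ih =>
      rw [List.range_succ, List.flatMap_append, ← List.append_assoc, ih, List.flatMap_singleton,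
        segment_append w (Nat.zero_le _) (idx_le_idx_succ hI m)]
  have := key #I
  rw [idx_of_le le_rfl] at this
  rw [← this, toWord, List.flatMap_cons, List.flatMap_map]

theorem wordCells_toWord {n : ℕ} {I : Finset ℕ} (hI : I ⊆ range n) (w : B n) :
    wordCells (toWord I w) = blockCells true (segment w 0 n) := by
  have key : ∀ m, blockCells true (segment w 0 (idx n I 0)) ++ ((List.range m).flatMap fun r =>
      blockCells (true ^^ (idx n I r).bodd) (segment w (idx n I r) (idx n I (r + 1)))) =
        blockCells true (segment w 0 (idx n I m)) := by
    intro m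
    induction m with
    | zero => simp
    | succ m ih =>
      rw [List.range_succ, List.flatMap_append, ← List.append_assoc, ih, List.flatMap_singleton,
        ← segment_append w (Nat.zero_le _) (idx_le_idx_succ hI m), blockCells_append,
        length_segment, Nat.sub_zero]
  have := key #I
  rw [idx_of_le le_rfl] at this
  rw [← this, wordCells, toWord, List.flatMap_cons, List.flatMap_map]

theorem mem_quotient {n : ℕ} {I : Finset ℕ} (hI : I ⊆ range n) {w : B n} :
    w ∈ quotient n (range n \ I) ↔ ∀ i < n, i ∉ I → ev w i < ev w (i + 1) := by
  rw [quotient, mem_filter, Finset.sdiff_sdiff_eq_self hI]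
  simp only [mem_univ, true_and]
  constructor
  · intro h i hi hiI
    refine (ev_lt_or_lt w i).resolve_right fun h' => hiI (h (mem_D.2 ⟨hi, h'⟩))
  · intro h i hi
    obtain ⟨hi, h'⟩ := mem_D.1 hi
    by_contra hiI
    exact absurd (h i hi hiI) (by omega)

theorem pairwise_segment_iff {n : ℕ} (w : B n) (a b : ℕ) :
    (segment w a b).Pairwise (· < ·) ↔
      ∀ i, a < i → i < b → ev w (i : ℕ) < ev w ((i : ℕ) + 1) := by
  rw [← List.isChain_iff_pairwise, List.isChain_iff_getElem]
  simp only [length_segment]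
  simp only [segment, List.getElem_map, List.getElem_range']
  constructor
  · intro h i hi hib
    have := h (i - a - 1) (by omega)
    have e1 : a + 1 * (i - a - 1) + 1 = i := by omega
    have e2 : a + 1 * (i - a - 1 + 1) = i := by omega
    rw [e2] at this
    rw [← Nat.cast_succ, Nat.succ_eq_add_one, e1] at this
    exact this
  · intro h i hi
    have := h (a + i + 1) (by omega) (by omega)
    have e1 : ((a + 1 * i : ℕ) : ℤ) + 1 = ((a + i + 1 : ℕ) : ℤ) := by push_cast; ring
    have e2 : ((a + 1 * (i + 1) : ℕ) : ℤ) + 1 = ((a + i + 1 : ℕ) : ℤ) + 1 := by push_cast; ring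
    rwa [e1, e2]

theorem isWord_toWord_iff {n : ℕ} {I : Finset ℕ} (hI : I ⊆ range n) (w : B n) :
    IsWord n (flaggedShape (idx n I 0) (pattern n I)) (toWord I w) ↔
      w ∈ quotient n (range n \ I) := by
  rw [mem_quotient hI]
  have hle : ∀ r, idx n I r ≤ n := fun r => by
    by_cases h : r < #I
    · exact (mem_range.1 (hI (idx_mem h))).le
    · rw [idx_of_le (by omega)]
  constructor
  · rintro ⟨-, h1, h2, -⟩ i hi hiI
    simp only [toWord, List.forall_mem_cons, pairwise_segment_iff] at h1 h2
    rcases exists_between_idx hi hiI with h | ⟨r, hr, h3, h4⟩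
    · rcases Nat.eq_zero_or_pos i with rfl | hpos
      · rw [Nat.cast_zero, ev_zero]
        exact h2.1 trivial _ (mem_segment.2 ⟨0, le_rfl, h, by simp⟩)
      · exact h1.1 i hpos h
    · exact (pairwise_segment_iff w _ _).1
        (h1.2 _ (List.mem_map.2 ⟨r, List.mem_range.2 hr, rfl⟩)) i h3 h4
  · intro h
    refine ⟨shape_toWord I w, ?_, ?_, ?_⟩
    · simp only [toWord, List.forall_mem_cons, pairwise_segment_iff]
      refine ⟨fun i _ hi => h i (hi.trans_le (hle 0)) (notMem_of_lt_idx_zero hI hi), ?_⟩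
      intro b hb
      obtain ⟨r, -, rfl⟩ := List.mem_map.1 hb
      exact (pairwise_segment_iff w _ _).2 fun i h1 h2 =>
        h i (h2.trans_le (hle _)) (notMem_of_idx_lt_of_lt_idx hI h1 h2)
    · simp only [toWord, List.forall_mem_cons]
      constructor
      · intro _ v hv
        obtain ⟨k, -, hk, rfl⟩ := mem_segment.1 hv
        induction k with
        | zero =>
          have := h 0 (hk.trans_le (hle 0)) (notMem_of_lt_idx_zero hI hk)
          rwa [Nat.cast_zero, ev_zero] at this
        | succ k ih =>
          have h1 := ih (by omega) (mem_segment.2 ⟨k, Nat.zero_le _, by omega, rfl⟩)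
          have h2 := h (k + 1) (hk.trans_le (hle 0)) (notMem_of_lt_idx_zero hI hk)
          push_cast at h2 ⊢
          omega
      · intro b hb hb'
        obtain ⟨r, -, rfl⟩ := List.mem_map.1 hb
        simp at hb'
    · rw [flatMap_toWord hI]
      exact segment_natAbs_perm w

theorem toWord_injective {n : ℕ} {I : Finset ℕ} (hI : I ⊆ range n) :
    Function.Injective (toWord (n := n) I) := by
  intro w u h
  have h1 : segment w 0 n = segment u 0 n := by rw [← flatMap_toWord hI, h, flatMap_toWord hI]
  refine eq_of_ev_eq fun j hj hjn => ?_
  have h2 := congrArg (·[j.toNat - 1]?) h1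
  have h3 : j.toNat - 1 < n := by omega
  have h4 : ((j.toNat - 1 : ℕ) : ℤ) + 1 = j := by omega
  simpa [segment, h3, h4] using h2

theorem exists_toWord_eq {n : ℕ} {I : Finset ℕ} (hI : I ⊆ range n) {x : List Block}
    (hx : IsWord n (flaggedShape (idx n I 0) (pattern n I)) x) : ∃ w : B n, toWord I w = x := by
  obtain ⟨w, hw⟩ := exists_segment_eq hx.perm
  refine ⟨w, ?_⟩
  have hsh : shape (toWord I w) = shape x := (shape_toWord I w).trans hx.shape_eq.symm
  have h1 : (toWord I w).map (fun b => b.2.2) = x.map fun b => b.2.2 := by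
    rw [List.eq_iff_flatten_eq]
    constructor
    · rw [← List.flatMap_def, ← List.flatMap_def, flatMap_toWord hI, hw]
    · have := congrArg (List.map fun c => c.2.2) hsh
      simpa [shape, Function.comp_def] using this
  have hlen : (toWord I w).length = x.length := by simpa [shape] using congrArg List.length hsh
  refine List.ext_getElem hlen fun k hk hk' => ?_
  have h2 := List.getElem_of_eq h1 (i := k) (by simpa using hk)
  have h3 := List.getElem_of_eq hsh (i := k) (by simpa [shape] using hk)
  simp only [List.getElem_map, shape, Prod.mk.injEq] at h2 h3
  exact Prod.ext h3.1 (Prod.ext h3.2.1 h2)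

/-- The signed distribution of `L` on a quotient is a signed weight sum over words. -/
theorem sum_quotient {R : Type*} [CommRing R] (q : R) {n : ℕ} {I : Finset ℕ} (hI : I ⊆ range n) :
    ∑ w ∈ quotient n (range n \ I), (-1) ^ len w * q ^ L w =
      ∑ x ∈ words n (flaggedShape (idx n I 0) (pattern n I)), cellsWeight q (wordCells x) := by
  refine sum_bij (fun w _ => toWord I w) ?_ ?_ ?_ ?_
  · intro w hw
    exact mem_words.2 ((isWord_toWord_iff hI w).2 hw)
  · intro w _ u _ h
    exact toWord_injective hI h
  · intro x hx
    rw [mem_words] at hx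
    obtain ⟨w, rfl⟩ := exists_toWord_eq hI hx
    exact ⟨w, (isWord_toWord_iff hI w).1 hx, rfl⟩
  · intro w _
    rw [wordCells_toWord hI, cellsWeight_segment]

/-! ### The function `f` -/

theorem x_pow_ne_one {k : ℕ} (hk : k ≠ 0) : x ^ k ≠ 1 := by
  intro h
  rw [x, ← map_pow, ← map_one (algebraMap ℤ[X] Frac)] at h
  have h' := congrArg natDegree (IsFractionRing.injective ℤ[X] Frac h)
  rw [natDegree_X_pow, natDegree_one] at h'
  exact hk h'

theorem qn_x_ne_zero (k : ℕ) : qn x k ≠ 0 := by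
  unfold qn
  split_ifs with h
  · exact one_ne_zero
  · exact sub_ne_zero.2 (x_pow_ne_one h).symm

theorem idx_zero_add_sum_pattern {n : ℕ} {I : Finset ℕ} (hI : I ⊆ range n) :
    idx n I 0 + ((pattern n I).map Prod.snd).sum = n := by
  have key : ∀ m, idx n I 0 + ((List.range m).map fun r => idx n I (r + 1) - idx n I r).sum =
      idx n I m := by
    intro m
    induction m with
    | zero => simp
    | succ m ih =>
      have := idx_le_idx_succ hI m
      rw [List.range_succ, List.map_append, List.sum_append, ← add_assoc, ih]
      simp only [List.map_cons, List.map_nil, List.sum_cons, List.sum_nil]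
      omega
  have := key #I
  rw [idx_of_le le_rfl] at this
  simpa [pattern, Function.comp_def] using this

/-- In the pattern of a quotient, each block starts with the expected parity. -/
theorem patternWeight_pattern {R : Type*} [CommRing R] (q : R) {n : ℕ} {I : Finset ℕ}
    (hI : I ⊆ range n) : patternWeight q (true ^^ (idx n I 0).bodd) (pattern n I) = 1 := by
  rw [pattern, List.range_eq_range']
  generalize 0 = s, #I = m
  induction m generalizing s with
  | zero => rfl
  | succ m ih =>
    obtain ⟨d, hd⟩ := Nat.exists_eq_add_of_le (idx_le_idx_succ hI s)
    have h := ih (s + 1)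
    rw [hd, Nat.bodd_add, ← Bool.xor_assoc] at h
    rw [List.range'_succ, List.map_cons, patternWeight]
    simp only [hd, Nat.add_sub_cancel_left]
    rw [h, blockWeight, if_pos rfl, mul_one]

theorem f_eq_wordSum {n : ℕ} {I : Finset ℕ} (hI : I ⊆ range n) :
    f n I = wordSum x (idx n I 0) (pattern n I) := by
  rw [wordSum, idx_zero_add_sum_pattern hI, patternWeight_pattern x hI, mul_one, f]
  congr 1
  rw [pattern, List.map_map, prod_range, ← List.prod_ofFn, List.ofFn_eq_map]
  simp [blockDen, Function.comp_def, ← List.map_coe_finRange_eq_range]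

/-- The formula for the signed distribution of `L`; it holds for every `I`. -/
theorem signedDistribution_eq_f {n : ℕ} {I : Finset ℕ} (hI : I ⊆ range n) :
    algebraMap ℤ[X] Frac (signedDistribution n I) = f n I := by
  rw [f_eq_wordSum hI, ← sum_cellsWeight x qn_x_ne_zero n _ _ (idx_zero_add_sum_pattern hI),
    ← sum_quotient x hI, signedDistribution, map_sum]
  simp [x]

theorem qfact_eq_prod_odd_mul_prod_even {R : Type*} [CommRing R] (q : R) (n : ℕ) :
    qfact q n = (∏ k ∈ range (n + 1) with Odd k, qn q k) * ∏ σ ∈ Icc 1 (n / 2), qn q (2 * σ) := by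
  induction n with
  | zero => simp [qfact, prod_filter]
  | succ n ih =>
    rw [qfact, prod_Icc_succ_top (by omega), ← qfact, ih, range_add_one (n := n + 1), filter_insert]
    rcases Nat.even_or_odd' n with ⟨k, rfl | rfl⟩
    · have h : (2 * k + 1) / 2 = 2 * k / 2 := by omega
      rw [if_pos ⟨k, rfl⟩, prod_insert (by simp), h]
      ring
    · have h1 : (2 * k + 1 + 1) / 2 = k + 1 := by omega
      have h2 : (2 * k + 1) / 2 = k := by omega
      rw [if_neg (by rw [Nat.not_odd_iff_even]; exact ⟨k + 1, by ring⟩), h1, h2,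
        prod_Icc_succ_top (by omega), mul_assoc]
      rfl

theorem qfact_sq {R : Type*} [CommRing R] (q : R) (a : ℕ) :
    qfact (q ^ 2) a = ∏ σ ∈ Icc 1 a, qn q (2 * σ) := by
  refine prod_congr rfl fun k _ => ?_
  simp [qn, pow_mul]

theorem qfact_two_mul {R : Type*} [CommRing R] (q : R) (a : ℕ) :
    qfact q (2 * a) = (∏ k ∈ range (2 * a) with Odd k, qn q k) * qfact (q ^ 2) a := by
  rw [qfact_eq_prod_odd_mul_prod_even, qfact_sq, Nat.mul_div_cancel_left a two_pos, range_add_one,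
    filter_insert, if_neg (by simp)]

theorem idx_singleton_zero (n : ℕ) : idx n {0} 0 = 0 :=
  mem_singleton.1 (idx_mem (n := n) (I := {0}) (by simp))

theorem f_singleton_zero (n : ℕ) : f n {0} = ∏ k ∈ range (n + 1) with Odd k, qn x k := by
  have h : ∏ σ ∈ Icc 1 (n / 2), qn x (2 * σ) ≠ 0 := prod_ne_zero_iff.2 fun _ _ => qn_x_ne_zero _
  rw [f, card_singleton, prod_range_one, idx_singleton_zero, idx_of_le (r := 0 + 1) (by simp),
    Nat.sub_zero, prod_inv_distrib, qfact_eq_prod_odd_mul_prod_even x n]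
  simp only [qfact, zero_lt_one, Icc_eq_empty_of_lt, prod_empty, div_one]
  exact mul_inv_cancel_right₀ h _

theorem idx_range {n r : ℕ} (h : r ≤ n) : idx n (range n) r = r := by
  rcases h.lt_or_eq with h | rfl
  · have h' : r < #(range n) := by rwa [card_range]
    rw [idx, dif_pos h']
    have := orderEmbOfFin_unique (s := range n) rfl (f := fun i : Fin #(range n) => (i : ℕ))
      (fun i => mem_range.2 (by simpa using i.2)) (fun _ _ h => h)
    exact (congrFun this ⟨r, h'⟩).symm
  · exact idx_of_le (by simp)

theorem f_range (n : ℕ) : f n (range n) = qfact x n := by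
  rw [f, card_range, idx_range (Nat.zero_le n), prod_eq_one]
  · simp [qfact]
  · intro r hr
    rw [mem_range] at hr
    rw [idx_range hr.le, idx_range (r := r + 1) hr, Nat.add_sub_cancel_left]
    simp

theorem card_image_half {I : Finset ℕ} (hE : ∀ i ∈ I, Even i) : #(I.image (· / 2)) = #I := by
  refine card_image_of_injOn fun a ha b hb h => ?_
  obtain ⟨c, rfl⟩ := hE a ha
  obtain ⟨d, rfl⟩ := hE b hb
  change (c + c) / 2 = (d + d) / 2 at h
  omega

theorem idx_image_half {n : ℕ} {I : Finset ℕ} (hE : ∀ i ∈ I, Even i) (r : ℕ) :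
    idx (n / 2) (I.image (· / 2)) r = idx n I r / 2 := by
  have hcard := card_image_half hE
  by_cases h : r < #I
  · have h' : r < #(I.image (· / 2)) := by rwa [hcard]
    rw [idx, idx, dif_pos h, dif_pos h']
    have := orderEmbOfFin_unique (s := I.image (· / 2)) rfl
      (f := fun i => I.orderEmbOfFin rfl (Fin.cast hcard i) / 2)
      (fun i => mem_image_of_mem _ (I.orderEmbOfFin_mem rfl _)) (fun i j hij => by
        have h1 : I.orderEmbOfFin rfl (Fin.cast hcard i) < I.orderEmbOfFin rfl (Fin.cast hcard j) :=
          (I.orderEmbOfFin rfl).strictMono hij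
        obtain ⟨c, hc⟩ := hE _ (I.orderEmbOfFin_mem rfl (Fin.cast hcard i))
        obtain ⟨d, hd⟩ := hE _ (I.orderEmbOfFin_mem rfl (Fin.cast hcard j))
        simp only
        omega)
    exact (congrFun this ⟨r, h'⟩).symm
  · rw [idx_of_le (by omega), idx_of_le (by omega)]

theorem prod_qbinom {K : Type*} [Field K] {q : K} (hq : ∀ a, qfact q a ≠ 0) (M : ℕ → ℕ) (l : ℕ) :
    ∏ r ∈ range l, qbinom q (M (r + 1)) (M r) =
      qfact q (M l) / qfact q (M 0) * ∏ r ∈ range l, (qfact q (M (r + 1) - M r))⁻¹ := by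
  induction l with
  | zero => simp [hq]
  | succ l ih =>
    rw [prod_range_succ, ih, prod_range_succ, qbinom]
    have := hq (M l)
    field_simp

theorem f_even {n : ℕ} {I : Finset ℕ} (hn : Even n) (hE : ∀ i ∈ I, Even i) :
    f n I = qmultinom (x ^ 2) (n / 2) (I.image (· / 2)) *
      ((∏ k ∈ range n with Odd k, qn x k) / ∏ k ∈ range (idx n I 0) with Odd k, qn x k) := by
  have heven : ∀ r, ∃ a, idx n I r = 2 * a := fun r => by
    by_cases h : r < #I
    · exact (hE _ (idx_mem h)).two_dvd
    · rw [idx_of_le (by omega)]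
      exact hn.two_dvd
  choose M hM using heven
  have hJ : ∀ r, idx (n / 2) (I.image (· / 2)) r = M r := fun r => by
    rw [idx_image_half hE, hM]
    omega
  have hq : ∀ a, qfact (x ^ 2) a ≠ 0 := fun a => by
    rw [qfact_sq]
    exact prod_ne_zero_iff.2 fun _ _ => qn_x_ne_zero _
  have hnM : n = 2 * M #I := by rw [← hM, idx_of_le le_rfl]
  have hdiff : ∀ r, ∏ σ ∈ Icc 1 ((idx n I (r + 1) - idx n I r) / 2), (qn x (2 * σ))⁻¹ =
      (qfact (x ^ 2) (M (r + 1) - M r))⁻¹ := fun r => by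
    rw [prod_inv_distrib, qfact_sq, hM, hM, ← Nat.mul_sub, Nat.mul_div_cancel_left _ two_pos]
  rw [f, qmultinom, card_image_half hE]
  simp only [hdiff, hJ]
  rw [prod_qbinom hq M, hM 0, qfact_two_mul, hnM, qfact_two_mul]
  simp only [← hnM]
  ring

end Hyperoctahedral

theorem theorem1p2 (n : ℕ) (hn : 0 < n) (I : Finset ℕ) (hI : I ⊆ Finset.range n) :
    (I = {0} →
      algebraMap (Polynomial ℤ) Hyperoctahedral.Frac (Hyperoctahedral.signedDistribution n I) =
          Hyperoctahedral.f n I ∧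
      Hyperoctahedral.f n I =
          ∏ k ∈ Finset.range (n + 1) with Odd k, Hyperoctahedral.qn Hyperoctahedral.x k) ∧
    (I = Finset.range n →
      algebraMap (Polynomial ℤ) Hyperoctahedral.Frac (Hyperoctahedral.signedDistribution n I) =
          Hyperoctahedral.f n I ∧
      Hyperoctahedral.f n I = Hyperoctahedral.qfact Hyperoctahedral.x n) ∧
    (Even n → (∀ i ∈ I, Even i) →
      algebraMap (Polynomial ℤ) Hyperoctahedral.Frac (Hyperoctahedral.signedDistribution n I) =
          Hyperoctahedral.f n I ∧
      Hyperoctahedral.f n I =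
          Hyperoctahedral.qmultinom (Hyperoctahedral.x ^ 2) (n / 2) (I.image (· / 2)) *
            ((∏ k ∈ Finset.range n with Odd k, Hyperoctahedral.qn Hyperoctahedral.x k) /
              ∏ k ∈ Finset.range (Hyperoctahedral.idx n I 0) with Odd k,
                Hyperoctahedral.qn Hyperoctahedral.x k)) := by
  have h := Hyperoctahedral.signedDistribution_eq_f hI
  refine ⟨?_, ?_, fun hev hE => ⟨h, Hyperoctahedral.f_even hev hE⟩⟩
  · rintro rfl
    exact ⟨h, Hyperoctahedral.f_singleton_zero n⟩
  · rintro rfl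
    exact ⟨h, Hyperoctahedral.f_range n⟩
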